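/- **Setting.** For $\sigma\in\mathbb R$ put $\Pi_\sigma=\{s\in\mathbb C:\operatorname{Re}s>\sigma\}$. Let $(a_n)_{n\ge1}$ be complex numbers with $a_n=O_\varepsilon(n^\varepsilon)$ for every $\varepsilon>0$. Let $\sigma_0<1$ and suppose that $L(s)=\sum_{n\ge1}a_nn^{-s}$ ($\operatorname{Re}s>1$) has a meromorphic continuation to $\Pi_{\sigma_0}$, again denoted $L$, whose only pole is at $s=1$, of order $m_L\ge1$, and that $(s-1)^{m_L}L(s)$ has finite order in $\Pi_{\sigma_0}$, i.e. it is $O(\exp(|s|^{\rho}))$ for some real $\rho$ as $|s|\to\infty$ in $\Pi_{\sigma_0}$. Let $\varphi:[0,\infty)\to\mathbb C$ be a Lebesgue measurable function, supported on $[0,1]$ and locally bounded on $(0,1)$, with $\varphi(x)=O(x^{-\sigma_0})$ as $x\to0^+$ and $\varphi(x)=O((1-x)^{-\sigma_1})$ as $x\to1^-$ for some $\sigma_1<1/2$. Put $\widehat\varphi(s)=\int_0^\infty\varphi(t)t^{s-1}\,dt$ for $s\in\Pi_{\sigma_0}$ and, for $u>0$, $$\psi_1(u)=\operatorname{Res}\big(L(s)\widehat\varphi(s)u^s,\,s=1\big),\qquad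 \psi(u)=\psi_1(u)-\sum_{1\le n<u}a_n\,\varphi\!\left(\frac nu\right).$$ Suppose that $r_0>\sigma_0$ satisfies $r_0<1$ and $\int_1^\infty|\psi(t)|^2\,\frac{dt}{t^{1+2r_0}}<\infty$. For $r_0\le r<1$ put $$\|\psi_1\|_{L^2((0,1),\frac{du}{u^{1+2r}})}=\Big(\int_0^1|\psi_1(u)|^2\frac{du}{u^{1+2r}}\Big)^{1/2},\qquad \|\psi\|_r=\Big(\int_1^\infty|\psi(u)|^2\frac{du}{u^{1+2r}}\Big)^{1/2},\qquad b_{1,r}(s)=\frac{s-1}{s+1-2r}.$$ **Proposition.** Let $r_0\le r<1$ and $\lambda\in\Pi_{\sigma_0}$. Then $L$ has no zeros on $$r-\sigma_0+\left\{\mu\in\mathbb C:\ \mu\ne2\sigma_0-\overline\lambda,\ \left|\frac{\mu-\lambda}{\mu+\overline\lambda-2\sigma_0}\right|<\sqrt{2(\operatorname{Re}\lambda-\sigma_0)}\;R\right\},$$ where $$R=\frac{\left|\big(L\,\widehat\varphi\,b_{1,r}^{m_L}\big)(\lambda+r-\sigma_0)\right|}{\|\psi_1\|_{L^2((0,1),\frac{du}{u^{1+2r}})}+\|\psi\|_r}.$$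 Here $L\,\widehat\varphi\,b_{1,r}^{m_L}$ denotes the holomorphic function on $\Pi_r$ obtained by removing the singularity at $s=1$. If the denominator vanishes, $R$ is read as $0$. The point $s=1$ is a pole of $L$ and is not counted as a zero. -/

import Mathlib

open Filter Topology Asymptotics MeasureTheory Set
open scoped ComplexConjugate

namespace ZeroFreeDisc

/-- The open half-plane `Π_σ = {s : Re s > σ}`. -/
def halfPlane (σ : ℝ) : Set ℂ := {s | σ < s.re}

/-- The assumptions on the Dirichlet series `L(s) = ∑_{n ≥ 1} a_n n^{-s}`, where the function `L`
is its meromorphic continuation to `Π_{σ₀}`, with a unique pole, of order `m ≥ 1`, at `s = 1`.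
The values of `L` at the pole `1` and outside `Π_{σ₀}` are unconstrained, and so is `a 0`. -/
structure IsContinuedDirichletSeries (a : ℕ → ℂ) (L : ℂ → ℂ) (σ₀ : ℝ) (m : ℕ) : Prop where
  /-- `a_n = O_ε(n^ε)` for every `ε > 0`. -/
  coeff_growth : ∀ ε : ℝ, 0 < ε → a =O[atTop] fun n : ℕ => (n : ℝ) ^ ε
  /-- On `Re s > 1` the function `L` is the sum of the Dirichlet series. -/
  eq_series : ∀ s : ℂ, 1 < s.re → L s = LSeries a s
  sigma_lt_one : σ₀ < 1
  /-- `L` is holomorphic in `Π_{σ₀}` except at `1`. -/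
  holomorphic : DifferentiableOn ℂ L (halfPlane σ₀ \ {1})
  one_le_order : 1 ≤ m
  /-- `L` has a pole of order exactly `m` at `1`. -/
  pole : meromorphicOrderAt L 1 = ((-(m : ℤ) : ℤ) : WithTop ℤ)
  /-- `(s - 1)^m L(s)` has finite order in `Π_{σ₀}`. -/
  finite_order : ∃ ρ : ℝ, (fun s : ℂ => (s - 1) ^ m * L s)
    =O[Bornology.cobounded ℂ ⊓ 𝓟 (halfPlane σ₀)] fun s : ℂ => Real.exp (‖s‖ ^ ρ)

/-- The assumptions on the weight `φ : [0, ∞) → ℂ` (values at negative reals play no role). -/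
structure IsWeight (φ : ℝ → ℂ) (σ₀ σ₁ : ℝ) : Prop where
  /-- `φ` is Lebesgue measurable on `(0, ∞)`. -/
  measurable : AEMeasurable φ (volume.restrict (Ioi 0))
  /-- `φ` is supported on `[0, 1]`. -/
  support : ∀ x : ℝ, 1 < x → φ x = 0
  /-- `φ` is locally bounded on `(0, 1)`. -/
  locally_bounded : ∀ x ∈ Ioo (0 : ℝ) 1, ∃ C : ℝ, ∀ᶠ y in 𝓝 x, ‖φ y‖ ≤ C
  bound_zero : φ =O[𝓝[>] (0 : ℝ)] fun x : ℝ => x ^ (-σ₀)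
  sigma_one_lt : σ₁ < 1 / 2
  bound_one : φ =O[𝓝[<] (1 : ℝ)] fun x : ℝ => (1 - x) ^ (-σ₁)

/-- The residue at `z` of a function `F` meromorphic at `z`: the value
`(2πi)⁻¹ ∮_{|s - z| = ε} F(s) ds` for all small `ε > 0`, written as the limit for `ε → 0⁺`. -/
noncomputable def residue (F : ℂ → ℂ) (z : ℂ) : ℂ :=
  limUnder (𝓝[>] (0 : ℝ)) fun ε : ℝ =>
    (2 * (Real.pi : ℂ) * Complex.I)⁻¹ * circleIntegral F z ε

/-- `ψ₁(u) = Res(L(s) φ̂(s) u^s, s = 1)`, where `φ̂(s) = ∫₀^∞ φ(t) t^(s-1) dt` is `mellin φ s`. -/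
noncomputable def psiOne (L : ℂ → ℂ) (φ : ℝ → ℂ) (u : ℝ) : ℂ :=
  residue (fun s : ℂ => L s * mellin φ s * (u : ℂ) ^ s) 1

/-- `ψ(u) = Res(L(s) φ̂(s) u^s, s = 1) - ∑_{n < u} a_n φ(n/u)` for `u > 0`;
the integers `1 ≤ n < ⌈u⌉` are exactly the integers `n ≥ 1` with `n < u`. -/
noncomputable def psi (a : ℕ → ℂ) (L : ℂ → ℂ) (φ : ℝ → ℂ) (u : ℝ) : ℂ :=
  psiOne L φ u - ∑ n ∈ Finset.Ico 1 ⌈u⌉₊, a n * φ ((n : ℝ) / u)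

/-- The norm of `f` in `L²(S, du/u^(1+2r))` for `S ⊆ (0, ∞)`. -/
noncomputable def weightedNorm (S : Set ℝ) (r : ℝ) (f : ℝ → ℂ) : ℝ :=
  Real.sqrt (∫ u in S, ‖f u‖ ^ 2 / u ^ (1 + 2 * r))

/-- The elementary Blaschke factor `b_{λ,r}(s) = (s - λ)/(s + conj λ - 2r)` of `Π_r`. -/
noncomputable def blaschke (lam : ℂ) (r : ℝ) (s : ℂ) : ℂ :=
  (s - lam) / (s + conj lam - 2 * (r : ℂ))

/-- The value at `s` of the holomorphic function `L φ̂ b_{1,r}^m` on `Π_r`. The limit gives the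
value of the pointwise product for `s ≠ 1`, and the removable singularity at `s = 1` (where the
zero of `b_{1,r}^m` compensates for the pole of `L`) is filled in. -/
noncomputable def compensatedValue (L : ℂ → ℂ) (φ : ℝ → ℂ) (m : ℕ) (r : ℝ) (s : ℂ) : ℂ :=
  limUnder (𝓝[≠] s) fun z : ℂ => L z * mellin φ z * blaschke 1 r z ^ m

/-- The quantity `R = |(L φ̂ b_{1,r}^m)(λ + r - σ₀)| / (‖ψ₁‖_{L²((0,1), du/u^(1+2r))} + ‖ψ‖_r)`,
where `‖ψ‖_r` is the norm of `ψ` in `L²((1,∞), du/u^(1+2r))`. -/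
noncomputable def radius (a : ℕ → ℂ) (L : ℂ → ℂ) (φ : ℝ → ℂ) (σ₀ : ℝ) (m : ℕ) (r : ℝ)
    (lam : ℂ) : ℝ :=
  ‖compensatedValue L φ m r (lam + (r : ℂ) - (σ₀ : ℂ))‖ /
    (weightedNorm (Ioo 0 1) r (psiOne L φ) + weightedNorm (Ioi 1) r (psi a L φ))

/-- The disc `{μ : |(μ - λ)/(μ + conj λ - 2σ₀)| < ρ}`; the quotient has to be defined at `μ`. -/
def disc (lam : ℂ) (σ₀ ρ : ℝ) : Set ℂ :=
  {μ | μ + conj lam - 2 * (σ₀ : ℂ) ≠ 0 ∧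
    ‖(μ - lam) / (μ + conj lam - 2 * (σ₀ : ℂ))‖ < ρ}

end ZeroFreeDisc

/-! Substitute `u = e^x` and put `α = 1 - r > 0`. The weighted function `e^{-rx} ψ(e^x)` becomes
`e^{αx} P(x) + q(x)`: the first term is the residue at `1`, with `deg P < m`, and `q` comes from the
smoothed partial sums. For `Re s > α` the Laplace transform of `q` at `s` is `-(L φ̂)(s + r)`. The
sum is square integrable on `(0, ∞)`, although its two terms need not be.

In the shifted variable, `b_{1,r}` is `(s - α)/(s + α)`. Multiplication by it is the operator `f ↦ f
- 2αg`, where `g' = -αg + f`. Since `|f - 2αg|² = |f|² - 2α (|g|²)'`, it preserves energy up to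
boundary terms. With the right initial value of `g`, it turns `e^{αx} P` into `e^{αx} R'`, where `R'
+ 2αR = P`, so the degree drops. The initial value costs `2α|R(0)|²`, which is exactly what `∫
|e^{αx} P|²` over `x < 0` loses. After `m` steps no polar part is left, and `-L φ̂ b_{1,r}^m` is the
Laplace transform of some `h` with `‖h‖² ≤ ‖ψ₁‖² + ‖ψ‖²` (`exists_memLp_laplace`,
`exists_laplace_eq`).

Such a transform lies in the Hardy space of the half-plane. If it vanishes at `s`, its value at `w`
is at most `‖h‖ / √(2 Re w)` times the pseudohyperbolic distance of `s` and `w`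
(`norm_laplace_sq_le_of_zero`). Hence no zero is too close to `λ`. -/

namespace ZeroFreeDisc

/-! ### Energy identity for a Blaschke factor acting on functions of `x` -/

/-- The solution `g` of `g' = -α g + f`, `g 0 = c`. -/
noncomputable def relax (α : ℝ) (c : ℂ) (f : ℝ → ℂ) (x : ℝ) : ℂ :=
  Real.exp (-α * x) • (c + ∫ y in (0 : ℝ)..x, Real.exp (α * y) • f y)

/-- Integrate `(f - 2αg)² = f² - 2α (g²)'`, which holds almost everywhere because `g' = f - αg`.
Absolute continuity of `g` suffices for this, so `f` need not be continuous. -/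
theorem energy_real {f : ℝ → ℝ} {α c X : ℝ}
    (hf : IntervalIntegrable f volume 0 X) (hf2 : IntervalIntegrable (fun x => f x ^ 2) volume 0 X)
:
    let g := fun x =>
      Real.exp (-α * x) * (c + ∫ y in (0 : ℝ)..x, Real.exp (α * y) * f y)
    IntervalIntegrable (fun x => (f x - 2 * α * g x) ^ 2) volume 0 X ∧
    ∫ x in (0 : ℝ)..X, (f x - 2 * α * g x) ^ 2
      = (∫ x in (0 : ℝ)..X, f x ^ 2) - 2 * α * (g X ^ 2 - c ^ 2) := by
  intro g
  have hk : IntervalIntegrable (fun y => Real.exp (α * y) * f y) volume 0 X :=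
    hf.continuousOn_mul (by fun_prop)
  have hGac : AbsolutelyContinuousOnInterval
      (fun x => c + ∫ y in (0 : ℝ)..x, Real.exp (α * y) * f y) 0 X :=
    (contDiffOn_const (c := c) (n := 1)).absolutelyContinuousOnInterval.fun_add
      (hk.absolutelyContinuousOnInterval_intervalIntegral (c := 0) (by simp))
  have hEac : AbsolutelyContinuousOnInterval (fun x => Real.exp (-α * x)) 0 X :=
    ContDiffOn.absolutelyContinuousOnInterval (by fun_prop)
  have hgac : AbsolutelyContinuousOnInterval g 0 X := by
    exact hEac.fun_mul hGac
  have hder : ∀ᵐ x, x ∈ uIcc 0 X → HasDerivAt g (f x - α * g x) x := by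
    filter_upwards [hk.ae_hasDerivAt_integral] with x hx hxm
    have h2 := (hx hxm 0 (by simp)).const_add c
    have h1 : HasDerivAt (fun x => Real.exp (-α * x)) (Real.exp (-α * x) * (-α)) x := by
      simpa using ((hasDerivAt_id x).const_mul (-α)).exp
    have h3 := h1.mul h2
    convert! h3 using 1
    have : Real.exp (-α * x) * Real.exp (α * x) = 1 := by rw [← Real.exp_add]; simp
    linear_combination (- f x) * this
  have hgc : ContinuousOn g (uIcc 0 X) := hgac.continuousOn
  have hmain : ∫ x in (0 : ℝ)..X, 2 * g x * (f x - α * g x) = g X ^ 2 - c ^ 2 := by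
    have h := AbsolutelyContinuousOnInterval.integral_deriv_mul_eq_sub hgac hgac
    have h0 : g 0 = c := by simp [g]
    rw [h0] at h
    rw [pow_two, pow_two, ← h]
    apply intervalIntegral.integral_congr_ae
    filter_upwards [hder] with x hx hxm
    rw [(hx (uIoc_subset_uIcc hxm)).deriv]
    ring
  have hint : IntervalIntegrable (fun x => 2 * α * (2 * g x * (f x - α * g x))) volume 0 X := by
    have h1 : IntervalIntegrable (fun x => f x - α * g x) volume 0 X :=
      hf.sub ((hgc.intervalIntegrable).const_mul α)
    exact (h1.continuousOn_mul (hgc.const_smul (2:ℝ))).const_mul _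
  have hexp : ∀ x, (f x - 2 * α * g x) ^ 2
      = f x ^ 2 - 2 * α * (2 * g x * (f x - α * g x)) := fun x => by ring
  simp only [hexp]
  refine ⟨hf2.sub hint, ?_⟩
  rw [← hmain, ← intervalIntegral.integral_const_mul, ← intervalIntegral.integral_sub hf2 hint]

theorem relax_re {α : ℝ} {c : ℂ} {f : ℝ → ℂ} {x : ℝ} (hf : IntervalIntegrable f volume 0 x) :
    (relax α c f x).re
      = Real.exp (-α * x) * (c.re + ∫ y in (0 : ℝ)..x, Real.exp (α * y) * (f y).re) := by
  have hk : IntervalIntegrable (fun y => Real.exp (α * y) • f y) volume 0 x :=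
    hf.continuousOn_smul (by fun_prop)
  have h := Complex.reCLM.intervalIntegral_comp_comm hk
  simp only [Complex.reCLM_apply, Complex.real_smul, Complex.re_ofReal_mul] at h
  rw [h, relax, Complex.real_smul, Complex.re_ofReal_mul, Complex.add_re]
  simp only [Complex.real_smul]

theorem relax_im {α : ℝ} {c : ℂ} {f : ℝ → ℂ} {x : ℝ} (hf : IntervalIntegrable f volume 0 x) :
    (relax α c f x).im
      = Real.exp (-α * x) * (c.im + ∫ y in (0 : ℝ)..x, Real.exp (α * y) * (f y).im) := by
  have hk : IntervalIntegrable (fun y => Real.exp (α * y) • f y) volume 0 x :=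
    hf.continuousOn_smul (by fun_prop)
  have h := Complex.imCLM.intervalIntegral_comp_comm hk
  simp only [Complex.imCLM_apply, Complex.real_smul, Complex.im_ofReal_mul] at h
  rw [h, relax, Complex.real_smul, Complex.im_ofReal_mul, Complex.add_im]
  simp only [Complex.real_smul]

theorem continuousOn_relax {α : ℝ} {c : ℂ} {f : ℝ → ℂ} {X : ℝ}
    (hf : IntervalIntegrable f volume 0 X) : ContinuousOn (relax α c f) (uIcc 0 X) := by
  have hk : IntervalIntegrable (fun y => Real.exp (α * y) • f y) volume 0 X :=
    hf.continuousOn_smul (by fun_prop)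
  have := intervalIntegral.continuousOn_primitive_interval' hk (by simp : (0:ℝ) ∈ uIcc 0 X)
  unfold relax
  fun_prop

/-- As `α` is real, real and imaginary parts evolve independently. -/
theorem energy_complex {f : ℝ → ℂ} {α X : ℝ} {c : ℂ}
    (hf : IntervalIntegrable f volume 0 X)
    (hf2 : IntervalIntegrable (fun x => ‖f x‖ ^ 2) volume 0 X) :
    IntervalIntegrable (fun x => ‖f x - 2 * α * relax α c f x‖ ^ 2) volume 0 X ∧
    ∫ x in (0 : ℝ)..X, ‖f x - 2 * α * relax α c f x‖ ^ 2
      = (∫ x in (0 : ℝ)..X, ‖f x‖ ^ 2) - 2 * α * (‖relax α c f X‖ ^ 2 - ‖c‖ ^ 2) := by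
  have hsq : ∀ z : ℂ, ‖z‖ ^ 2 = z.re ^ 2 + z.im ^ 2 := fun z => by
    rw [Complex.sq_norm, Complex.normSq_apply]; ring
  have hre : IntervalIntegrable (fun x => (f x).re) volume 0 X :=
    ⟨hf.1.re, hf.2.re⟩
  have him : IntervalIntegrable (fun x => (f x).im) volume 0 X :=
    ⟨hf.1.im, hf.2.im⟩
  have hre2 : IntervalIntegrable (fun x => (f x).re ^ 2) volume 0 X := by
    refine hf2.mono_fun ((IntervalIntegrable.aestronglyMeasurable_restrict_uIoc hre).pow 2) (Eventually.of_forall fun x => ?_)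
    simp only [norm_pow, hsq, Real.norm_eq_abs, sq_abs]
    rw [abs_of_nonneg (by positivity)]
    nlinarith [sq_nonneg (f x).im]
  have him2 : IntervalIntegrable (fun x => (f x).im ^ 2) volume 0 X := by
    refine hf2.mono_fun ((IntervalIntegrable.aestronglyMeasurable_restrict_uIoc him).pow 2) (Eventually.of_forall fun x => ?_)
    simp only [norm_pow, hsq, Real.norm_eq_abs, sq_abs]
    rw [abs_of_nonneg (by positivity)]
    nlinarith [sq_nonneg (f x).re]
  obtain ⟨i1, e1⟩ := energy_real (α := α) (c := c.re) hre hre2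
  obtain ⟨i2, e2⟩ := energy_real (α := α) (c := c.im) him him2
  have hsub : ∀ x ∈ uIcc 0 X, IntervalIntegrable f volume 0 x := fun x hx =>
    hf.mono_set (uIcc_subset_uIcc (by simp) hx)
  have hcongr : ∀ x ∈ uIcc 0 X,
      ((f x).re - 2 * α * (Real.exp (-α * x) *
        (c.re + ∫ y in (0 : ℝ)..x, Real.exp (α * y) * (f y).re))) ^ 2 +
      ((f x).im - 2 * α * (Real.exp (-α * x) *
        (c.im + ∫ y in (0 : ℝ)..x, Real.exp (α * y) * (f y).im))) ^ 2
      = ‖f x - 2 * α * relax α c f x‖ ^ 2 := by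
    intro x hx
    rw [← relax_re (hsub x hx), ← relax_im (hsub x hx), hsq]
    simp
  refine ⟨(i1.add i2).congr fun x hx => hcongr x (uIoc_subset_uIcc hx), ?_⟩
  rw [← intervalIntegral.integral_congr hcongr, intervalIntegral.integral_add i1 i2, e1, e2]
  beta_reduce
  rw [← relax_re hf, ← relax_im hf, hsq, hsq c]
  simp only [hsq]
  rw [intervalIntegral.integral_add hre2 him2]
  ring

theorem intervalIntegrable_of_memLp {f : ℝ → ℂ} (hf : MemLp f 2 (volume.restrict (Ioi 0))) {X : ℝ}
    (hX : 0 ≤ X) : IntervalIntegrable f volume 0 X := by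
  rw [intervalIntegrable_iff_integrableOn_Ioc_of_le hX]
  exact ((hf.mono_measure (Measure.restrict_mono Ioc_subset_Ioi_self le_rfl)).integrable
    (by norm_num) : Integrable f _)

theorem integrableOn_sq_of_memLp {f : ℝ → ℂ} {S : Set ℝ} (hf : MemLp f 2 (volume.restrict S)) :
    IntegrableOn (fun x => ‖f x‖ ^ 2) S := by
  exact hf.integrable_norm_pow (p := 2) (by norm_num)

theorem continuousOn_relax_Ici {α : ℝ} {c : ℂ} {f : ℝ → ℂ}
    (hf : MemLp f 2 (volume.restrict (Ioi 0))) : ContinuousOn (relax α c f) (Ici 0) := by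
  intro x hx
  have hx : 0 ≤ x := hx
  have h := continuousOn_relax (α := α) (c := c)
    (intervalIntegrable_of_memLp hf (by linarith : (0:ℝ) ≤ x + 1))
  rw [uIcc_of_le (by linarith)] at h
  refine (h x ⟨hx, by linarith⟩).mono_of_mem_nhdsWithin ?_
  rw [← Ici_inter_Iic]
  exact inter_mem_nhdsWithin _ (Iic_mem_nhds (by linarith))

theorem energy_bound {f : ℝ → ℂ} {α : ℝ} (c : ℂ) (hα : 0 < α)
    (hf : MemLp f 2 (volume.restrict (Ioi 0))) :
    MemLp (fun x => f x - 2 * α * relax α c f x) 2 (volume.restrict (Ioi 0)) ∧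
    ∫ x in Ioi (0 : ℝ), ‖f x - 2 * α * relax α c f x‖ ^ 2
      ≤ (∫ x in Ioi (0 : ℝ), ‖f x‖ ^ 2) + 2 * α * ‖c‖ ^ 2 := by
  have hm : AEStronglyMeasurable (fun x => f x - 2 * α * relax α c f x)
      (volume.restrict (Ioi 0)) :=
    hf.1.sub ((((continuousOn_relax_Ici hf).mono Ioi_subset_Ici_self).aestronglyMeasurable
      measurableSet_Ioi).const_mul _)
  have hsq := integrableOn_sq_of_memLp hf
  have key : ∀ X : ℝ, 0 ≤ X →
      IntervalIntegrable (fun x => ‖f x - 2 * α * relax α c f x‖ ^ 2) volume 0 X ∧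
      ∫ x in (0 : ℝ)..X, ‖f x - 2 * α * relax α c f x‖ ^ 2
        ≤ (∫ x in Ioi (0 : ℝ), ‖f x‖ ^ 2) + 2 * α * ‖c‖ ^ 2 := by
    intro X hX
    have hX2 : IntegrableOn (fun x => ‖f x‖ ^ 2) (Ioc 0 X) := hsq.mono_set Ioc_subset_Ioi_self
    obtain ⟨h1, h2⟩ := energy_complex (α := α) (c := c) (intervalIntegrable_of_memLp hf hX)
      ((intervalIntegrable_iff_integrableOn_Ioc_of_le hX).2 hX2)
    refine ⟨h1, ?_⟩
    rw [h2]
    have h3 : ∫ x in (0 : ℝ)..X, ‖f x‖ ^ 2 ≤ ∫ x in Ioi (0 : ℝ), ‖f x‖ ^ 2 := by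
      rw [intervalIntegral.integral_of_le hX]
      exact setIntegral_mono_set hsq (Eventually.of_forall fun x => by positivity)
        Ioc_subset_Ioi_self.eventuallyLE
    -- The boundary term at `X` has a favourable sign and is dropped; only the initial value `c` is
    -- charged.
    nlinarith [mul_nonneg hα.le (sq_nonneg ‖relax α c f X‖)]
  have hint : IntegrableOn (fun x => ‖f x - 2 * α * relax α c f x‖ ^ 2) (Ioi 0) := by
    refine integrableOn_Ioi_of_intervalIntegral_norm_bounded
      ((∫ x in Ioi (0 : ℝ), ‖f x‖ ^ 2) + 2 * α * ‖c‖ ^ 2) 0 (b := fun X : ℝ => max X 0)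
      (l := atTop) (fun X => ?_) (tendsto_atTop_mono (fun X => le_max_left X 0) tendsto_id)
      (Eventually.of_forall fun X => ?_)
    · exact (intervalIntegrable_iff_integrableOn_Ioc_of_le (le_max_right _ _)).1
        (key _ (le_max_right _ _)).1
    · simpa using (key _ (le_max_right X 0)).2
  refine ⟨(memLp_two_iff_integrable_sq_norm hm).2 hint, ?_⟩
  refine le_of_tendsto (intervalIntegral_tendsto_integral_Ioi 0 hint tendsto_id) ?_
  filter_upwards [eventually_ge_atTop 0] with X hX using (key X hX).2

/-! ### Polar parts `e^{αx} P(x)` -/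

open Polynomial in
theorem degree_derivative_lt_of_lt_succ {P : ℂ[X]} {n : ℕ} (hP : P.degree < (n + 1 : ℕ)) :
    (derivative P).degree < n := by
  rw [degree_lt_iff_coeff_zero] at hP ⊢
  intro k hk
  rw [coeff_derivative, hP (k + 1) (by omega), zero_mul]

open Polynomial in
/-- Every polynomial `P` has the form `R' + c R` with `deg R ≤ deg P`, if `c ≠ 0`. -/
theorem exists_derivative_add_mul_eq {c : ℂ} (hc : c ≠ 0) (n : ℕ) :
    ∀ P : ℂ[X], P.degree < n → ∃ R : ℂ[X], R.degree < n ∧ derivative R + C c * R = P := by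
  induction n with
  | zero =>
    intro P hP
    have : P = 0 := by simpa [degree_eq_bot, Nat.WithBot.lt_zero_iff] using hP
    exact ⟨0, by simp, by simp [this]⟩
  | succ n ih =>
    intro P hP
    have hR0 : (C c⁻¹ * P).degree < (n + 1 : ℕ) := by
      rwa [degree_C_mul (inv_ne_zero hc)]
    obtain ⟨R, hR, hRe⟩ := ih (-derivative (C c⁻¹ * P)) (by
      rw [degree_neg]
      exact degree_derivative_lt_of_lt_succ hR0)
    -- `P / c` solves the equation up to the error `(P / c)'`, of smaller degree, which `R`
    -- corrects.
    refine ⟨C c⁻¹ * P + R, (degree_add_le _ _).trans_lt (max_lt hR0 (hR.trans ?_)), ?_⟩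
    · exact_mod_cast Nat.lt_succ_self n
    · have h1 : C c * C c⁻¹ = 1 := by rw [← C_mul, mul_inv_cancel₀ hc, C_1]
      rw [derivative_add, mul_add, ← mul_assoc, h1]
      linear_combination hRe

section

open Polynomial

/-- The function `x ↦ e^{αx} P(x)`. -/
noncomputable def expPoly (α : ℝ) (P : ℂ[X]) (x : ℝ) : ℂ := Real.exp (α * x) * P.eval (x : ℂ)

theorem continuous_expPoly (α : ℝ) (P : ℂ[X]) : Continuous (expPoly α P) := by
  unfold expPoly
  have : Continuous fun x : ℝ => P.eval (x : ℂ) := P.continuous.comp Complex.continuous_ofReal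
  fun_prop

theorem hasDerivAt_eval_ofReal (P : ℂ[X]) (x : ℝ) :
    HasDerivAt (fun x : ℝ => P.eval (x : ℂ)) ((derivative P).eval (x : ℂ)) x :=
  (P.hasDerivAt (x : ℂ)).comp_ofReal

/-- The initial value `R(0)` selects the solution without an `e^{-αx}` component, so the polar part
keeps its shape. -/
theorem relax_expPoly {α : ℝ} {P R : ℂ[X]} (hR : derivative R + C (2 * (α : ℂ)) * R = P) (x : ℝ) :
    relax α (R.eval 0) (expPoly α P) x = expPoly α R x := by
  have hd : ∀ y : ℝ, HasDerivAt (fun y : ℝ => (Real.exp (2 * α * y) : ℂ) * R.eval (y : ℂ))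
      (Real.exp (α * y) • expPoly α P y) y := by
    intro y
    have h1 : HasDerivAt (fun y : ℝ => (Real.exp (2 * α * y) : ℂ))
        ((Real.exp (2 * α * y) * (2 * α) : ℝ) : ℂ) y :=
      HasDerivAt.ofReal_comp (by simpa using ((hasDerivAt_id y).const_mul (2 * α)).exp)
    convert! h1.mul (hasDerivAt_eval_ofReal R y) using 1
    have h2 : Real.exp (2 * α * y) = Real.exp (α * y) * Real.exp (α * y) := by
      rw [← Real.exp_add]; ring_nf
    rw [expPoly, ← hR, h2, Complex.real_smul]
    simp
    ring
  have hi : ∫ y in (0 : ℝ)..x, Real.exp (α * y) • expPoly α P y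
      = (Real.exp (2 * α * x) : ℂ) * R.eval (x : ℂ) - R.eval 0 := by
    rw [intervalIntegral.integral_eq_sub_of_hasDerivAt (fun y _ => hd y)
      (Continuous.intervalIntegrable (by have := continuous_expPoly α P; fun_prop) _ _)]
    simp
  rw [relax, hi, expPoly, Complex.real_smul]
  have h2 : (Real.exp (-α * x) : ℂ) * (Real.exp (2 * α * x) : ℂ) = (Real.exp (α * x) : ℂ) := by
    rw [← Complex.ofReal_mul, ← Real.exp_add]; ring_nf
  linear_combination (R.eval (x : ℂ)) * h2

theorem eval_isLittleO_exp (P : ℂ[X]) {β : ℝ} (hβ : 0 < β) :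
    (fun x : ℝ => P.eval (x : ℂ)) =o[atTop] fun x : ℝ => Real.exp (β * x) := by
  induction P using Polynomial.induction_on' with
  | add p q hp hq => simpa only [eval_add] using hp.add hq
  | monomial n a =>
    simp only [eval_monomial]
    refine IsLittleO.const_mul_left ?_ a
    refine IsLittleO.of_norm_left ?_
    have := (isLittleO_pow_exp_pos_mul_atTop n hβ).norm_left
    simpa using this

theorem eval_neg_isLittleO_exp (P : ℂ[X]) {β : ℝ} (hβ : 0 < β) :
    (fun x : ℝ => P.eval (-x : ℂ)) =o[atTop] fun x : ℝ => Real.exp (β * x) := by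
  simpa using eval_isLittleO_exp (P.comp (-X)) hβ

theorem expPoly_neg_isBigO {α : ℝ} (hα : 0 < α) (P : ℂ[X]) :
    (fun x : ℝ => expPoly α P (-x)) =O[atTop] fun x : ℝ => Real.exp (-(α / 2) * x) := by
  have h := (isBigO_refl (fun x : ℝ => (Real.exp (-α * x) : ℂ)) atTop).norm_right.mul
    (eval_neg_isLittleO_exp P (half_pos hα)).isBigO
  refine h.congr (fun x => ?_) (fun x => ?_)
  · simp [expPoly]
  · rw [Complex.norm_real, Real.norm_eq_abs, Real.abs_exp, ← Real.exp_add]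
    ring_nf

theorem integrableOn_expPoly_neg_sq {α : ℝ} (hα : 0 < α) (P : ℂ[X]) :
    IntegrableOn (fun x : ℝ => ‖expPoly α P (-x)‖ ^ 2) (Ioi 0) := by
  refine integrable_of_isBigO_exp_neg (b := α) hα ?_ ?_
  · exact (by have := continuous_expPoly α P; fun_prop : Continuous _).continuousOn
  · refine ((expPoly_neg_isBigO hα P).norm_left.pow 2).trans (IsBigO.of_norm_le fun x => ?_)
    rw [← Real.exp_nat_mul]
    simp
    linarith

/-- This is the energy identity on the negative half-line, where `e^{αx} R(x)` decays at `-∞`. The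
gain `2α|R(0)|²` pays for the initial value in `energy_bound`. -/
theorem integral_expPoly_neg_sq {α : ℝ} (hα : 0 < α) {P R : ℂ[X]}
    (hR : derivative R + C (2 * (α : ℂ)) * R = P) :
    (∫ x in Ioi (0 : ℝ), ‖expPoly α (derivative R) (-x)‖ ^ 2) + 2 * α * ‖R.eval 0‖ ^ 2
      = ∫ x in Ioi (0 : ℝ), ‖expPoly α P (-x)‖ ^ 2 := by
  have hexp : ∀ (Q : ℂ[X]) (x : ℝ), ‖expPoly α Q (-x)‖ ^ 2
      = Real.exp (-(2 * α) * x) * ‖Q.eval (-x : ℂ)‖ ^ 2 := by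
    intro Q x
    rw [expPoly, norm_mul, mul_pow, Complex.norm_real, Real.norm_eq_abs, Real.abs_exp,
      ← Real.exp_nat_mul]
    push_cast
    ring_nf
  have hd : ∀ x : ℝ, HasDerivAt (fun x : ℝ => -(2 * α) * ‖expPoly α R (-x)‖ ^ 2)
      (‖expPoly α P (-x)‖ ^ 2 - ‖expPoly α (derivative R) (-x)‖ ^ 2) x := by
    intro x
    have h1 : HasDerivAt (fun x : ℝ => R.eval (-x : ℂ)) (-(derivative R).eval (-x : ℂ)) x := by
      simpa [Function.comp_def] using (hasDerivAt_eval_ofReal R (-x)).scomp x (hasDerivAt_neg x)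
    have h2 : HasDerivAt (fun x : ℝ => Real.exp (-(2 * α) * x))
        (Real.exp (-(2 * α) * x) * (-(2 * α))) x := by
      simpa using ((hasDerivAt_id x).const_mul (-(2 * α))).exp
    simp only [hexp]
    convert! (h2.mul h1.norm_sq).const_mul (-(2 * α)) using 1
    rw [← hR]
    simp only [Complex.sq_norm, Complex.normSq_apply, Complex.inner]
    simp
    ring
  have hlim : Tendsto (fun x : ℝ => -(2 * α) * ‖expPoly α R (-x)‖ ^ 2) atTop (𝓝 0) := by
    have h1 : Tendsto (fun x : ℝ => expPoly α R (-x)) atTop (𝓝 0) := by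
      refine (expPoly_neg_isBigO hα R).trans_tendsto ?_
      refine Real.tendsto_exp_atBot.comp ?_
      exact tendsto_id.const_mul_atTop_of_neg (by linarith)
    simpa using (h1.norm.pow 2).const_mul (-(2 * α))
  have h := integral_Ioi_of_hasDerivAt_of_tendsto' (fun x _ => hd x)
    ((integrableOn_expPoly_neg_sq hα P).sub (integrableOn_expPoly_neg_sq hα (derivative R))) hlim
  rw [integral_sub (integrableOn_expPoly_neg_sq hα P)
    (integrableOn_expPoly_neg_sq hα (derivative R))] at h
  simp [expPoly] at h ⊢
  linarith

end

/-! ### Laplace transforms of square integrable functions -/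

/-- The one-sided Laplace transform. -/
noncomputable def laplace (f : ℝ → ℂ) (s : ℂ) : ℂ :=
  ∫ x in Ioi (0 : ℝ), Complex.exp (-s * x) * f x

theorem norm_cexp_neg_mul (s : ℂ) (x : ℝ) : ‖Complex.exp (-s * x)‖ = Real.exp (-s.re * x) := by
  rw [Complex.norm_exp]; simp

theorem integrableOn_cexp_neg {s : ℂ} (hs : 0 < s.re) :
    IntegrableOn (fun x : ℝ => Complex.exp (-s * x)) (Ioi 0) :=
  integrableOn_exp_mul_complex_Ioi (by simpa using hs) 0

theorem integral_cexp_neg {s : ℂ} (hs : 0 < s.re) :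
    ∫ x in Ioi (0 : ℝ), Complex.exp (-s * x) = 1 / s := by
  rw [integral_exp_mul_complex_Ioi (by simpa using hs) 0]
  simp [div_neg, neg_div]

theorem memLp_cexp_neg {s : ℂ} (hs : 0 < s.re) :
    MemLp (fun x : ℝ => Complex.exp (-s * x)) 2 (volume.restrict (Ioi 0)) := by
  refine (memLp_two_iff_integrable_sq_norm
    (Continuous.aestronglyMeasurable (by fun_prop))).2 ?_
  have h := (exp_neg_integrableOn_Ioi 0 (by linarith : 0 < 2 * s.re))
  refine h.congr (Eventually.of_forall fun x => ?_)
  simp only [norm_cexp_neg_mul]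
  rw [← Real.exp_nat_mul]
  push_cast
  ring_nf

theorem integrableOn_laplace {f : ℝ → ℂ} (hf : MemLp f 2 (volume.restrict (Ioi 0))) {s : ℂ}
    (hs : 0 < s.re) : IntegrableOn (fun x : ℝ => Complex.exp (-s * x) * f x) (Ioi 0) :=
  (memLp_cexp_neg hs).integrable_mul hf

theorem norm_integral_mul_sq_le {μ : Measure ℝ} {f k : ℝ → ℂ} (hf : MemLp f 2 μ)
    (hk : MemLp k 2 μ) :
    ‖∫ x, k x * f x ∂μ‖ ^ 2 ≤ (∫ x, ‖k x‖ ^ 2 ∂μ) * ∫ x, ‖f x‖ ^ 2 ∂μ := by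
  have h1 : ‖∫ x, k x * f x ∂μ‖ ≤ ∫ x, ‖k x‖ * ‖f x‖ ∂μ := by
    simpa using norm_integral_le_integral_norm (μ := μ) (fun x => k x * f x)
  have h2 := integral_mul_le_Lp_mul_Lq_of_nonneg (μ := μ) (p := 2) (q := 2)
    Real.HolderConjugate.two_two
    (Eventually.of_forall fun x => norm_nonneg (k x))
    (Eventually.of_forall fun x => norm_nonneg (f x)) (by simpa using hk.norm)
    (by simpa using hf.norm)
  simp only [Real.rpow_two, ← Real.sqrt_eq_rpow] at h2
  calc ‖∫ x, k x * f x ∂μ‖ ^ 2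
      ≤ (√(∫ x, ‖k x‖ ^ 2 ∂μ) * √(∫ x, ‖f x‖ ^ 2 ∂μ)) ^ 2 := by
        gcongr
        exact h1.trans h2
    _ = _ := by
        rw [mul_pow, Real.sq_sqrt (integral_nonneg fun x => by positivity),
          Real.sq_sqrt (integral_nonneg fun x => by positivity)]

/-- Cauchy–Schwarz against `e^{-wx}`, whose squared norm is `1 / (2 Re w)`. -/
theorem norm_laplace_sq_le {f : ℝ → ℂ} (hf : MemLp f 2 (volume.restrict (Ioi 0))) {w : ℂ}
    (hw : 0 < w.re) :
    ‖laplace f w‖ ^ 2 * (2 * w.re) ≤ ∫ x in Ioi (0 : ℝ), ‖f x‖ ^ 2 := by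
  have h := norm_integral_mul_sq_le hf (memLp_cexp_neg hw)
  have h2 : ∫ x in Ioi (0 : ℝ), ‖Complex.exp (-w * x)‖ ^ 2 = 1 / (2 * w.re) := by
    have := integral_exp_mul_Ioi (by linarith : -(2 * w.re) < 0) 0
    simp only [norm_cexp_neg_mul, ← Real.exp_nat_mul]
    push_cast
    simp only [neg_mul, mul_neg, mul_zero, Real.exp_zero, ← mul_assoc] at this ⊢
    rw [this]
    field_simp
  rw [h2, one_div_mul_eq_div, le_div_iff₀ (by linarith)] at h
  exact h

/-- The coefficient makes the difference orthogonal to `e^{-sx}`, so this is the squared distance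
from `e^{-wx}` to the line spanned by `e^{-sx}`. -/
theorem integral_kernel_sub_sq {w s : ℂ} (hw : 0 < w.re) (hs : 0 < s.re) :
    ∫ x in Ioi (0 : ℝ), ‖Complex.exp (-w * x)
        - (s + conj s) / (w + conj s) * Complex.exp (-s * x)‖ ^ 2
      = ‖(s - w) / (s + conj w)‖ ^ 2 / (2 * w.re) := by
  have hww : 0 < (w + conj w).re := by simpa using hw
  have hss : 0 < (s + conj s).re := by simpa using hs
  have hws : 0 < (w + conj s).re := by simp; linarith
  have hsw : 0 < (s + conj w).re := by simp; linarith
  have ne : ∀ z : ℂ, 0 < z.re → z ≠ 0 := fun z hz h => by simp [h] at hz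
  set c : ℂ := (s + conj s) / (w + conj s) with hc
  have hexp : ∀ x : ℝ, ((‖Complex.exp (-w * x) - c * Complex.exp (-s * x)‖ ^ 2 : ℝ) : ℂ)
      = Complex.exp (-(w + conj w) * x) - conj c * Complex.exp (-(w + conj s) * x)
        - c * Complex.exp (-(s + conj w) * x) + c * conj c * Complex.exp (-(s + conj s) * x) := by
    intro x
    have e : ∀ a b : ℂ, Complex.exp (-(a + conj b) * x)
        = Complex.exp (-a * x) * conj (Complex.exp (-b * x)) := by
      intro a b
      rw [← Complex.exp_conj, ← Complex.exp_add]
      simp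
      ring_nf
    rw [e, e, e, e]
    push_cast
    rw [← Complex.mul_conj']
    simp only [map_sub, map_mul]
    ring
  have i1 := integrableOn_cexp_neg hww
  have i2 := (integrableOn_cexp_neg hws).const_mul (conj c)
  have i3 := (integrableOn_cexp_neg hsw).const_mul c
  have i4 := (integrableOn_cexp_neg hss).const_mul (c * conj c)
  have i12 : IntegrableOn (fun x : ℝ => Complex.exp (-(w + conj w) * x)
      - conj c * Complex.exp (-(w + conj s) * x)) (Ioi 0) := i1.sub i2
  have i123 : IntegrableOn (fun x : ℝ => Complex.exp (-(w + conj w) * x)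
      - conj c * Complex.exp (-(w + conj s) * x) - c * Complex.exp (-(s + conj w) * x)) (Ioi 0) :=
    i12.sub i3
  rw [← Complex.ofReal_inj, ← integral_complex_ofReal]
  simp only [hexp]
  rw [integral_add i123 i4, integral_sub i12 i3, integral_sub i1 i2,
    integral_const_mul, integral_const_mul, integral_const_mul, integral_cexp_neg hww,
    integral_cexp_neg hws, integral_cexp_neg hsw, integral_cexp_neg hss, Complex.ofReal_div,
    Complex.ofReal_pow, ← Complex.mul_conj']
  have h2w : ((2 * w.re : ℝ) : ℂ) = w + conj w := by rw [Complex.add_conj]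
  rw [h2w, hc]
  simp only [map_div₀, map_add, map_sub, Complex.conj_conj]
  have hws' : conj w + s ≠ 0 := by rw [add_comm]; exact ne _ hsw
  have hsw' : conj s + w ≠ 0 := by rw [add_comm]; exact ne _ hws
  have hss' : conj s + s ≠ 0 := by rw [add_comm]; exact ne _ hss
  have := ne _ hww
  have := ne _ hws
  have := ne _ hsw
  have := ne _ hss
  field_simp
  ring

/-- A zero at `s` allows any multiple of `e^{-sx}` to be subtracted from the kernel `e^{-wx}`; the
orthogonal projection is the best choice in Cauchy–Schwarz. -/
theorem norm_laplace_sq_le_of_zero {f : ℝ → ℂ} (hf : MemLp f 2 (volume.restrict (Ioi 0)))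
    {w s : ℂ} (hw : 0 < w.re) (hs : 0 < s.re) (h0 : laplace f s = 0) :
    ‖laplace f w‖ ^ 2 * (2 * w.re)
      ≤ ‖(s - w) / (s + conj w)‖ ^ 2 * ∫ x in Ioi (0 : ℝ), ‖f x‖ ^ 2 := by
  set c : ℂ := (s + conj s) / (w + conj s) with hc
  have hk := (memLp_cexp_neg hw).sub ((memLp_cexp_neg hs).const_mul c)
  have h := norm_integral_mul_sq_le hf hk
  have e : laplace f w = ∫ x in Ioi (0 : ℝ),
      (Complex.exp (-w * x) - c * Complex.exp (-s * x)) * f x := by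
    simp only [sub_mul, mul_assoc]
    rw [integral_sub (integrableOn_laplace hf hw) ((integrableOn_laplace hf hs).const_mul c),
      integral_const_mul]
    change _ = laplace f w - c * laplace f s
    rw [h0]
    ring
  simp only [Pi.sub_apply] at h
  rw [← e, integral_kernel_sub_sq hw hs, div_mul_eq_mul_div, le_div_iff₀ (by linarith)] at h
  exact h

theorem differentiableAt_laplace {f : ℝ → ℂ} (hf : MemLp f 2 (volume.restrict (Ioi 0))) {s : ℂ}
    (hs : 0 < s.re) : DifferentiableAt ℂ (laplace f) s := by
  set δ : ℝ := s.re / 2 with hδ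
  have hδ0 : 0 < δ := by positivity
  have hbi : IntegrableOn (fun x : ℝ => 2 / δ * ‖Complex.exp (-((δ / 2 : ℝ) : ℂ) * x) * f x‖)
      (Ioi 0) :=
    ((integrableOn_laplace hf (s := ((δ / 2 : ℝ) : ℂ)) (by simpa using hδ0)).norm).const_mul _
  refine (hasDerivAt_integral_of_dominated_loc_of_deriv_le
    (F := fun z (x : ℝ) => Complex.exp (-z * x) * f x) (s := Metric.ball s δ)
    (F' := fun z (x : ℝ) => -x * Complex.exp (-z * x) * f x)
    (Metric.ball_mem_nhds s hδ0) (Eventually.of_forall fun z => ?_) (integrableOn_laplace hf hs)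
    ?_ ?_ hbi ?_).2.differentiableAt
  · exact (Continuous.aestronglyMeasurable (by fun_prop)).mul hf.1
  · exact (Continuous.aestronglyMeasurable (by fun_prop)).mul hf.1
  · filter_upwards [ae_restrict_mem measurableSet_Ioi] with x hx z hz
    have hx : 0 < x := hx
    have hzre : δ ≤ z.re := by
      have h1 := (Complex.abs_re_le_norm (z - s)).trans (mem_ball_iff_norm.1 hz).le
      rw [Complex.sub_re, abs_le] at h1
      linarith [h1.1]
    -- The factor `x` from differentiation is absorbed by half of the decay `e^{-δx}` available on
    -- the ball.
    have h3 : x ≤ 2 / δ * Real.exp (δ / 2 * x) := by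
      have := (Real.add_one_le_exp (δ / 2 * x))
      rw [div_mul_eq_mul_div, le_div_iff₀ hδ0]
      linarith
    rw [norm_mul, norm_mul, norm_mul, norm_cexp_neg_mul, norm_cexp_neg_mul, ← mul_assoc]
    refine mul_le_mul_of_nonneg_right ?_ (norm_nonneg _)
    rw [norm_neg, Complex.norm_real, Real.norm_of_nonneg hx.le, Complex.ofReal_re]
    calc x * Real.exp (-z.re * x) ≤ 2 / δ * Real.exp (δ / 2 * x) * Real.exp (-δ * x) := by
          gcongr
      _ = 2 / δ * Real.exp (-(δ / 2) * x) := by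
          rw [mul_assoc, ← Real.exp_add]; ring_nf
  · filter_upwards with x z _
    have h1 : HasDerivAt (fun z : ℂ => Complex.exp (-z * x)) (Complex.exp (-z * x) * (-x)) z := by
      simpa using (((hasDerivAt_id z).neg.mul_const (x : ℂ))).cexp
    convert! h1.mul_const (f x) using 1
    ring

/-- With zero initial value, `relax` is the one-sided convolution with `e^{-αx}`, whose transform is
`1 / (s + α)`. -/
theorem laplace_relax {q : ℝ → ℂ} {α : ℝ} {s : ℂ}
    (hq : IntegrableOn (fun x : ℝ => Complex.exp (-s * x) * q x) (Ioi 0)) (hs : 0 < (s + α).re) :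
    IntegrableOn (fun x : ℝ => Complex.exp (-s * x) * relax α 0 q x) (Ioi 0) ∧
    laplace (relax α 0 q) s = laplace q s / (s + α) := by
  have hg := integrableOn_cexp_neg hs
  have key : ∀ x : ℝ, Complex.exp (-s * x) * relax α 0 q x = ∫ t in (0 : ℝ)..x,
      ContinuousLinearMap.mul ℝ ℂ (Complex.exp (-s * t) * q t)
        (Complex.exp (-(s + α) * ((x - t : ℝ) : ℂ))) := by
    intro x
    rw [relax, zero_add, Complex.real_smul, ← mul_assoc, ← intervalIntegral.integral_const_mul]
    congr 1 with t
    rw [ContinuousLinearMap.mul_apply', Complex.real_smul, Complex.ofReal_exp, Complex.ofReal_exp]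
    have : Complex.exp (-s * x) * Complex.exp ((-α * x : ℝ) : ℂ) * Complex.exp ((α * t : ℝ) : ℂ)
        = Complex.exp (-s * t) * Complex.exp (-(s + α) * ((x - t : ℝ) : ℂ)) := by
      rw [← Complex.exp_add, ← Complex.exp_add, ← Complex.exp_add]
      congr 1
      push_cast
      ring
    linear_combination q t * this
  constructor
  · have h := (integrable_posConvolution hq hg (ContinuousLinearMap.mul ℝ ℂ)).integrableOn
      (s := Ioi 0)
    refine h.congr_fun (fun x hx => ?_) measurableSet_Ioi
    rw [posConvolution, indicator_of_mem hx, key]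
  · have h := integral_posConvolution hq hg (ContinuousLinearMap.mul ℝ ℂ)
    rw [laplace]
    simp only [key]
    rw [h, integral_cexp_neg hs, ContinuousLinearMap.mul_apply', laplace, mul_one_div]

/-! ### Removing the polar part -/

section

open Polynomial

theorem integrableOn_laplace_expPoly {α : ℝ} (P : ℂ[X]) {s : ℂ} (hs : α < s.re) :
    IntegrableOn (fun x : ℝ => Complex.exp (-s * x) * expPoly α P x) (Ioi 0) := by
  have hc : Continuous fun x : ℝ => Complex.exp (-s * x) * expPoly α P x := by
    have := continuous_expPoly α P
    fun_prop
  refine (integrable_norm_iff hc.aestronglyMeasurable).1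
    (integrable_of_isBigO_exp_neg (b := (s.re - α) / 2) (by linarith) hc.norm.continuousOn
      (IsBigO.norm_left ?_))
  · have h := (isBigO_refl (fun x : ℝ => Complex.exp (-(s - α) * x)) atTop).norm_right.mul
      (eval_isLittleO_exp P (by linarith : 0 < (s.re - α) / 2)).isBigO
    refine h.congr (fun x => ?_) (fun x => ?_)
    · rw [expPoly, ← mul_assoc, Complex.ofReal_exp, ← Complex.exp_add]
      congr 2
      push_cast
      ring
    · rw [norm_cexp_neg_mul, ← Real.exp_add, Complex.sub_re, Complex.ofReal_re]
      ring_nf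

/-- Multiplying the transform of `q` by `((s - α)/(s + α))^n` cancels the polar part coming from
`e^{αx} P(x)`, without increasing the `L²` norm of the two-sided function. -/
theorem exists_memLp_laplace {α : ℝ} (hα : 0 < α) (n : ℕ) : ∀ (P : ℂ[X]) (q : ℝ → ℂ),
    P.degree < n → MemLp (fun x => expPoly α P x + q x) 2 (volume.restrict (Ioi 0)) →
    ∃ h : ℝ → ℂ, MemLp h 2 (volume.restrict (Ioi 0)) ∧
      ∫ x in Ioi (0 : ℝ), ‖h x‖ ^ 2 ≤ (∫ x in Ioi (0 : ℝ), ‖expPoly α P (-x)‖ ^ 2)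
        + ∫ x in Ioi (0 : ℝ), ‖expPoly α P x + q x‖ ^ 2 ∧
      ∀ s : ℂ, α < s.re → laplace h s = ((s - α) / (s + α)) ^ n * laplace q s := by
  induction n with
  | zero =>
    intro P q hP hf
    have hP0 : P = 0 := by simpa [degree_eq_bot, Nat.WithBot.lt_zero_iff] using hP
    refine ⟨q, by simpa [hP0, expPoly] using hf, by simp [hP0, expPoly], by simp⟩
  | succ n ih =>
    intro P q hP hf
    have hα2 : (2 * (α : ℂ)) ≠ 0 := by
      simpa using hα.ne'
    obtain ⟨R, hRd, hR⟩ := exists_derivative_add_mul_eq hα2 (n + 1) P hP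
    have hqi : ∀ s : ℂ, α < s.re →
        IntegrableOn (fun x : ℝ => Complex.exp (-s * x) * q x) (Ioi 0) := by
      intro s hs
      refine ((integrableOn_laplace hf (s := s) (by linarith)).sub
        (integrableOn_laplace_expPoly P hs)).congr (Eventually.of_forall fun x => ?_)
      simp only [Pi.sub_apply]
      ring
    have hqloc : ∀ x : ℝ, 0 ≤ x → IntervalIntegrable q volume 0 x := by
      intro x hx
      refine ((intervalIntegrable_of_memLp hf hx).sub
        ((continuous_expPoly α P).intervalIntegrable 0 x)).congr fun y _ => ?_
      simp
    -- By linearity the initial value `R(0)` is assigned entirely to the polar part and `0` to `q`.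
    -- The former becomes `e^{αx} (P - 2αR) = e^{αx} R'`.
    have hstep : ∀ x ∈ Ioi (0 : ℝ),
        (expPoly α P x + q x)
          - 2 * α * relax α (R.eval 0) (fun x => expPoly α P x + q x) x
        = expPoly α (derivative R) x + (q x - 2 * α * relax α 0 q x) := by
      intro x hx
      have hx : 0 < x := hx
      have hadd : relax α (R.eval 0) (fun x => expPoly α P x + q x) x
          = relax α (R.eval 0) (expPoly α P) x + relax α 0 q x := by
        have i1 : IntervalIntegrable (fun y => Real.exp (α * y) • expPoly α P y) volume 0 x :=
          ((continuous_expPoly α P).intervalIntegrable 0 x).continuousOn_smul (by fun_prop)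
        have i2 : IntervalIntegrable (fun y => Real.exp (α * y) • q y) volume 0 x :=
          (hqloc x hx.le).continuousOn_smul (by fun_prop)
        simp only [relax, smul_add]
        rw [intervalIntegral.integral_add i1 i2]
        simp only [smul_add, smul_zero]
        ring
      rw [hadd, relax_expPoly hR, ← hR]
      simp only [expPoly, eval_add, eval_mul, eval_C]
      ring
    obtain ⟨hm, hle⟩ := energy_bound (R.eval 0) hα hf
    have hm' : MemLp (fun x => expPoly α (derivative R) x + (q x - 2 * α * relax α 0 q x)) 2
        (volume.restrict (Ioi 0)) :=
      hm.ae_eq ((ae_restrict_mem measurableSet_Ioi).mono hstep)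
    obtain ⟨h, hh, hhle, hhL⟩ := ih (derivative R) (fun x => q x - 2 * α * relax α 0 q x)
      (degree_derivative_lt_of_lt_succ hRd) hm'
    refine ⟨h, hh, ?_, ?_⟩
    · rw [setIntegral_congr_fun measurableSet_Ioi
        (fun x hx => congrArg (fun z => ‖z‖ ^ 2) (hstep x hx))] at hle
      have := integral_expPoly_neg_sq hα hR
      linarith
    · intro s hs
      have hs2 : 0 < (s + α).re := by simp; linarith
      have hne : s + α ≠ 0 := fun h0 => by simp [h0] at hs2
      obtain ⟨ir, er⟩ := laplace_relax (hqi s hs) hs2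
      have hlq : laplace (fun x => q x - 2 * α * relax α 0 q x) s
          = (s - α) / (s + α) * laplace q s := by
        have : laplace (fun x => q x - 2 * α * relax α 0 q x) s
            = laplace q s - 2 * α * laplace (relax α 0 q) s := by
          rw [laplace, laplace, laplace, ← integral_const_mul,
            ← integral_sub (hqi s hs) (ir.const_mul _)]
          congr 1 with x
          ring
        rw [this, er]
        field_simp
        ring
      rw [hhL s hs, hlq, pow_succ]
      ring

end

/-! ### The pole at `1` and the shape of `ψ₁` -/

theorem isOpen_halfPlane (σ : ℝ) : IsOpen (halfPlane σ) :=
  isOpen_lt continuous_const Complex.continuous_re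

/-- The residue of `h(s)/(s - z)^(n+1)` is a Taylor coefficient of `h`. -/
theorem residue_eq_iteratedDeriv {F h : ℂ → ℂ} {z : ℂ} {n : ℕ}
    (hh : ∀ᶠ s in 𝓝 z, DifferentiableAt ℂ h s)
    (hF : ∀ᶠ s in 𝓝[≠] z, F s = 1 / (s - z) ^ (n + 1) * h s) :
    residue F z = iteratedDeriv n h z / n.factorial := by
  rw [eventually_nhdsWithin_iff] at hF
  obtain ⟨δ, hδ, hball⟩ := Metric.eventually_nhds_iff_ball.1 (hh.and hF)
  refine Tendsto.limUnder_eq (tendsto_const_nhds.congr' ?_)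
  filter_upwards [Ioo_mem_nhdsGT hδ] with ε hε
  have hsub : Metric.closedBall z ε ⊆ Metric.ball z δ :=
    Metric.closedBall_subset_ball hε.2
  have hd : DifferentiableOn ℂ h (Metric.closedBall z ε) := fun s hs =>
    (hball s (hsub hs)).1.differentiableWithinAt
  have hI := hd.circleIntegral_one_div_sub_center_pow_smul hε.1 n
  have hc : circleIntegral F z ε = ∮ s in C(z, ε), (1 / (s - z) ^ (n + 1)) • h s := by
    refine circleIntegral.integral_congr hε.1.le fun s hs => ?_
    have hne : s ≠ z := fun h => by
      rw [h, mem_sphere_iff_norm, sub_self, norm_zero] at hs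
      exact hε.1.ne hs
    rw [smul_eq_mul]
    exact (hball s (hsub (Metric.sphere_subset_closedBall hs))).2 hne
  rw [hc, hI, smul_eq_mul]
  have := Complex.two_pi_I_ne_zero
  field_simp

theorem iteratedDeriv_cpow_const {u : ℝ} (hu : 0 < u) (k : ℕ) (s : ℂ) :
    iteratedDeriv k (fun s : ℂ => (u : ℂ) ^ s) s = (Real.log u : ℂ) ^ k * (u : ℂ) ^ s := by
  have h : (fun s : ℂ => (u : ℂ) ^ s) = fun s : ℂ => Complex.exp ((Real.log u : ℂ) * s) := by
    funext s
    rw [Complex.cpow_def_of_ne_zero (by exact_mod_cast hu.ne'), Complex.ofReal_log hu.le]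
  rw [congrFun h s, h, iteratedDeriv_cexp_const_mul]

-- Each derivative of `u^s` in `s` brings down a factor `log u`, so the Leibniz rule makes the
-- residue a polynomial in `log u` times `u`.
open Polynomial in
theorem exists_polynomial_psiOne {L Lt : ℂ → ℂ} {φ : ℝ → ℂ} {n : ℕ}
    (hLt : ∀ᶠ s in 𝓝 (1 : ℂ), DifferentiableAt ℂ Lt s)
    (hL : ∀ᶠ s in 𝓝[≠] (1 : ℂ), Lt s = (s - 1) ^ (n + 1) * L s)
    (hφ : ∀ᶠ s in 𝓝 (1 : ℂ), DifferentiableAt ℂ (mellin φ) s) :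
    ∃ P : ℂ[X], P.degree < (n + 1 : ℕ) ∧
      ∀ u : ℝ, 0 < u → psiOne L φ u = u * P.eval (Real.log u : ℂ) := by
  set H : ℂ → ℂ := fun s => Lt s * mellin φ s with hH
  have hHd : ∀ᶠ s in 𝓝 (1 : ℂ), DifferentiableAt ℂ H s := by
    filter_upwards [hLt, hφ] with s h1 h2 using h1.mul h2
  refine ⟨C ((n.factorial : ℂ)⁻¹) * ∑ i ∈ Finset.range (n + 1),
    C ((n.choose i : ℂ) * iteratedDeriv i H 1) * X ^ (n - i), ?_, fun u hu => ?_⟩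
  · rw [degree_C_mul (inv_ne_zero (by exact_mod_cast n.factorial_ne_zero))]
    refine (degree_sum_le _ _).trans_lt
      ((Finset.sup_lt_iff (WithBot.bot_lt_coe _)).2 fun i _ => ?_)
    refine (degree_C_mul_X_pow_le _ _).trans_lt ?_
    exact_mod_cast (by omega : n - i < n + 1)
  · have hud : ∀ s : ℂ, DifferentiableAt ℂ (fun s : ℂ => (u : ℂ) ^ s) s := fun s =>
      DifferentiableAt.const_cpow differentiableAt_id (Or.inl (by exact_mod_cast hu.ne'))
    have hres : psiOne L φ u
        = iteratedDeriv n (fun s => H s * (u : ℂ) ^ s) 1 / n.factorial := by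
      refine residue_eq_iteratedDeriv ?_ ?_
      · filter_upwards [hHd] with s hs using hs.mul (hud s)
      · filter_upwards [hL, self_mem_nhdsWithin] with s hs hne
        have : s - 1 ≠ 0 := sub_ne_zero.2 hne
        simp only [hH, hs]
        field_simp
    have hHc : ContDiffAt ℂ n H 1 :=
      (Complex.analyticAt_iff_eventually_differentiableAt.2 hHd).contDiffAt
    have huc : ContDiffAt ℂ n (fun s : ℂ => (u : ℂ) ^ s) 1 :=
      (Complex.analyticAt_iff_eventually_differentiableAt.2
        (Eventually.of_forall hud)).contDiffAt
    rw [hres, iteratedDeriv_fun_mul hHc huc]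
    simp only [iteratedDeriv_cpow_const hu, eval_mul, eval_C, eval_finsetSum, eval_pow, eval_X,
      Complex.cpow_one]
    rw [div_eq_inv_mul, Finset.mul_sum, Finset.mul_sum, Finset.mul_sum]
    refine Finset.sum_congr rfl fun i _ => ?_
    ring

theorem IsContinuedDirichletSeries.exists_holomorphic_multiple {a : ℕ → ℂ} {L : ℂ → ℂ} {σ₀ : ℝ} {m : ℕ}
    (hL : IsContinuedDirichletSeries a L σ₀ m) :
    ∃ Lt : ℂ → ℂ, DifferentiableOn ℂ Lt (halfPlane σ₀) ∧
      ∀ s, s ≠ 1 → Lt s = (s - 1) ^ m * L s := by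
  have hm := hL.one_le_order
  -- A function that is not meromorphic has order `0` by convention, which `m ≥ 1` excludes.
  have hmer : MeromorphicAt L 1 := by
    by_contra h
    have h1 := hL.pole
    rw [meromorphicOrderAt_of_not_meromorphicAt h] at h1
    have h2 : (0 : ℤ) = -(m : ℤ) := by exact_mod_cast h1
    omega
  obtain ⟨g, hg, -, hgL⟩ := (meromorphicOrderAt_eq_int_iff hmer).1 hL.pole
  set Lt : ℂ → ℂ := Function.update (fun s => (s - 1) ^ m * L s) 1 (g 1) with hLt
  have hne : ∀ s, s ≠ 1 → Lt s = (s - 1) ^ m * L s := fun s hs => by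
    rw [hLt, Function.update_of_ne hs]
  refine ⟨Lt, fun s hs => DifferentiableAt.differentiableWithinAt ?_, hne⟩
  by_cases h1 : s = 1
  · subst h1
    have : Lt =ᶠ[𝓝 1] g := by
      rw [eventually_nhdsWithin_iff] at hgL
      filter_upwards [hgL] with z hz
      by_cases hz1 : z = 1
      · rw [hz1, hLt, Function.update_self]
      · have hz0 : z - 1 ≠ 0 := sub_ne_zero.2 hz1
        rw [hne z hz1, hz hz1, smul_eq_mul, zpow_neg, zpow_natCast, ← mul_assoc,
          mul_inv_cancel₀ (pow_ne_zero _ hz0), one_mul]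
    exact hg.differentiableAt.congr_of_eventuallyEq this
  · have hopen : IsOpen (halfPlane σ₀ \ {1}) :=
      (isOpen_halfPlane σ₀).sdiff isClosed_singleton
    have hd : DifferentiableAt ℂ (fun s => (s - 1) ^ m * L s) s :=
      (by fun_prop : DifferentiableAt ℂ (fun s : ℂ => (s - 1) ^ m) s).mul
        (hL.holomorphic.differentiableAt (hopen.mem_nhds ⟨hs, h1⟩))
    refine hd.congr_of_eventuallyEq ?_
    filter_upwards [isOpen_ne.mem_nhds h1] with z hz using hne z hz

/-! ### The weight and its Mellin transform -/

theorem IsWeight.locallyIntegrableOn {φ : ℝ → ℂ} {σ₀ σ₁ : ℝ} (hφ : IsWeight φ σ₀ σ₁) :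
    LocallyIntegrableOn φ (Ioi 0) := by
  intro x hx
  have hx : 0 < x := hx
  have hmeas : StronglyMeasurableAtFilter φ (𝓝[Ioi 0] x) volume :=
    ⟨Ioi 0, self_mem_nhdsWithin, hφ.measurable.aestronglyMeasurable⟩
  have hfin : volume.FiniteAtFilter (𝓝[Ioi 0] x) :=
    (volume.finiteAt_nhds x).filter_mono nhdsWithin_le_nhds
  rcases lt_trichotomy x 1 with h | h | h
  · obtain ⟨C, hC⟩ := hφ.locally_bounded x ⟨hx, h⟩
    exact hfin.integrableAtFilter hmeas
      ⟨C, eventually_map.2 (hC.filter_mono nhdsWithin_le_nhds)⟩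
  · subst h
    obtain ⟨c, hc⟩ := hφ.bound_one.bound
    obtain ⟨l, hl, hlc⟩ := (mem_nhdsLT_iff_exists_Ioo_subset' (zero_lt_one' ℝ)).1 hc
    set d := max l 0 with hd
    have hd1 : d < 1 := max_lt hl one_pos
    have hd0 : 0 ≤ d := le_max_right _ _
    have i1 : IntegrableOn φ (Ioo d 1) := by
      have h1 : IntervalIntegrable (fun x : ℝ => (1 - x) ^ (-σ₁)) volume (1 - (1 - d)) (1 - 0) :=
        (intervalIntegral.intervalIntegrable_rpow' (a := 1 - d) (b := 0)
          (by linarith [hφ.sigma_one_lt] : -1 < -σ₁)).comp_sub_left 1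
      rw [sub_sub_cancel, sub_zero, intervalIntegrable_iff_integrableOn_Ioo_of_le hd1.le] at h1
      refine Integrable.mono' (h1.norm.const_mul c)
        (hφ.measurable.aestronglyMeasurable.mono_measure
          (Measure.restrict_mono (fun y hy => hd0.trans_lt hy.1) le_rfl)) ?_
      filter_upwards [ae_restrict_mem measurableSet_Ioo] with y hy
      exact hlc ⟨(le_max_left _ _).trans_lt hy.1, hy.2⟩
    have i2 : IntegrableOn φ (Ioo 1 2) := by
      refine integrableOn_zero.congr_fun (fun y hy => ?_) measurableSet_Ioo
      exact (hφ.support y hy.1).symm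
    -- The value `φ 1` is arbitrary but sits on a null set.
    have i3 : IntegrableOn φ {1} := by simp
    refine ⟨(Ioo d 1 ∪ {1}) ∪ Ioo 1 2, mem_nhdsWithin_of_mem_nhds ?_, (i1.union i3).union i2⟩
    filter_upwards [Ioo_mem_nhds hd1 (by norm_num : (1 : ℝ) < 2)] with y hy
    rcases lt_trichotomy y 1 with h | h | h
    · exact Or.inl (Or.inl ⟨hy.1, h⟩)
    · exact Or.inl (Or.inr h)
    · exact Or.inr ⟨h, hy.2⟩
  · refine hfin.integrableAtFilter hmeas ⟨0, eventually_map.2 (Eventually.filter_mono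
      nhdsWithin_le_nhds ?_)⟩
    filter_upwards [Ioi_mem_nhds h] with y hy
    simp [hφ.support y hy]

theorem IsWeight.isBigO_atTop {φ : ℝ → ℂ} {σ₀ σ₁ : ℝ} (hφ : IsWeight φ σ₀ σ₁) (b : ℝ) :
    φ =O[atTop] fun x : ℝ => x ^ b := by
  refine (isBigO_zero _ _).congr' ?_ EventuallyEq.rfl
  filter_upwards [eventually_gt_atTop 1] with y hy using (hφ.support y hy).symm

theorem IsWeight.mellinConvergent {φ : ℝ → ℂ} {σ₀ σ₁ : ℝ} (hφ : IsWeight φ σ₀ σ₁) {s : ℂ}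
    (hs : σ₀ < s.re) : MellinConvergent φ s :=
  mellinConvergent_of_isBigO_rpow hφ.locallyIntegrableOn (hφ.isBigO_atTop (-(s.re + 1)))
    (by linarith) hφ.bound_zero hs

theorem IsWeight.differentiableAt_mellin {φ : ℝ → ℂ} {σ₀ σ₁ : ℝ} (hφ : IsWeight φ σ₀ σ₁) {s : ℂ}
    (hs : σ₀ < s.re) : DifferentiableAt ℂ (mellin φ) s :=
  mellin_differentiableAt_of_isBigO_rpow hφ.locallyIntegrableOn (hφ.isBigO_atTop (-(s.re + 1)))
    (by linarith) hφ.bound_zero hs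

/-! ### The substitutions `u = e^x` and `u = e^{-x}` -/

theorem hasDerivWithinAt_exp_neg (x : ℝ) (S : Set ℝ) :
    HasDerivWithinAt (fun x : ℝ => Real.exp (-x)) (-Real.exp (-x)) S x := by
  have := ((hasDerivAt_neg x).exp).hasDerivWithinAt (s := S)
  simpa using this

theorem injOn_exp_neg (S : Set ℝ) : InjOn (fun x : ℝ => Real.exp (-x)) S :=
  fun _ _ _ _ h => neg_injective (Real.exp_injective h)

theorem image_exp_neg_Ioi : (fun x : ℝ => Real.exp (-x)) '' Ioi 0 = Ioo 0 1 := by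
  ext u
  constructor
  · rintro ⟨x, hx, rfl⟩
    exact ⟨Real.exp_pos _, Real.exp_lt_one_iff.2 (by simpa using hx)⟩
  · rintro ⟨h0, h1⟩
    exact ⟨-Real.log u, by simpa using Real.log_neg h0 h1, by simp [Real.exp_log h0]⟩

theorem image_exp_Ioi : Real.exp '' Ioi 0 = Ioi 1 := by
  ext u
  constructor
  · rintro ⟨x, hx, rfl⟩
    exact Real.one_lt_exp_iff.2 hx
  · intro h
    have h : 1 < u := h
    exact ⟨Real.log u, Real.log_pos h, Real.exp_log (by linarith)⟩

theorem exp_smul_sq_div (r x : ℝ) (z : ℂ) :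
    Real.exp x * (‖z‖ ^ 2 / Real.exp x ^ (1 + 2 * r)) = ‖(Real.exp (-r * x) : ℂ) * z‖ ^ 2 := by
  rw [← Real.exp_mul, norm_mul, mul_pow, Complex.norm_real, Real.norm_eq_abs, Real.abs_exp,
    ← Real.exp_nat_mul, div_eq_mul_inv, ← Real.exp_neg, mul_comm (‖z‖ ^ 2), ← mul_assoc,
    ← Real.exp_add]
  push_cast
  ring_nf

theorem integrableOn_Ioi_one_iff (r : ℝ) (f : ℝ → ℂ) :
    IntegrableOn (fun u : ℝ => ‖f u‖ ^ 2 / u ^ (1 + 2 * r)) (Ioi 1) ↔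
      IntegrableOn (fun x : ℝ => ‖(Real.exp (-r * x) : ℂ) * f (Real.exp x)‖ ^ 2) (Ioi 0) := by
  rw [← image_exp_Ioi, integrableOn_image_iff_integrableOn_abs_deriv_smul measurableSet_Ioi
    (fun x _ => (Real.hasDerivAt_exp x).hasDerivWithinAt) Real.exp_injective.injOn]
  simp only [Real.abs_exp, smul_eq_mul, exp_smul_sq_div]

theorem weightedNorm_Ioi_one (r : ℝ) (f : ℝ → ℂ) :
    weightedNorm (Ioi 1) r f
      = √(∫ x in Ioi (0 : ℝ), ‖(Real.exp (-r * x) : ℂ) * f (Real.exp x)‖ ^ 2) := by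
  rw [weightedNorm, ← image_exp_Ioi, integral_image_eq_integral_abs_deriv_smul measurableSet_Ioi
    (fun x _ => (Real.hasDerivAt_exp x).hasDerivWithinAt) Real.exp_injective.injOn]
  simp only [Real.abs_exp, smul_eq_mul, exp_smul_sq_div]

theorem weightedNorm_Ioo_zero_one (r : ℝ) (f : ℝ → ℂ) :
    weightedNorm (Ioo 0 1) r f
      = √(∫ x in Ioi (0 : ℝ), ‖(Real.exp (r * x) : ℂ) * f (Real.exp (-x))‖ ^ 2) := by
  rw [weightedNorm, ← image_exp_neg_Ioi, integral_image_eq_integral_abs_deriv_smul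
    measurableSet_Ioi (fun x _ => hasDerivWithinAt_exp_neg x _) (injOn_exp_neg _)]
  simp only [abs_neg, Real.abs_exp, smul_eq_mul, exp_smul_sq_div, neg_mul_neg]

theorem exp_neg_smul_cpow (s : ℂ) (x : ℝ) (z : ℂ) :
    Real.exp (-x) • ((Real.exp (-x) : ℂ) ^ (s - 1) • z) = Complex.exp (-s * x) * z := by
  have hne : ((Real.exp (-x) : ℝ) : ℂ) ≠ 0 := by exact_mod_cast (Real.exp_pos _).ne'
  rw [Complex.real_smul, smul_eq_mul, ← mul_assoc, Complex.cpow_def_of_ne_zero hne,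
    ← Complex.ofReal_log (Real.exp_pos _).le, Real.log_exp, Complex.ofReal_exp, ← Complex.exp_add]
  congr 2
  push_cast
  ring

theorem IsWeight.integrableOn_laplace {φ : ℝ → ℂ} {σ₀ σ₁ : ℝ} (hφ : IsWeight φ σ₀ σ₁) {s : ℂ}
    (hs : σ₀ < s.re) :
    IntegrableOn (fun x : ℝ => Complex.exp (-s * x) * φ (Real.exp (-x))) (Ioi 0) := by
  have h : IntegrableOn (fun t : ℝ => (t : ℂ) ^ (s - 1) • φ t) (Ioo 0 1) :=
    (hφ.mellinConvergent hs).mono_set Ioo_subset_Ioi_self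
  rw [← image_exp_neg_Ioi, integrableOn_image_iff_integrableOn_abs_deriv_smul
    measurableSet_Ioi (fun x _ => hasDerivWithinAt_exp_neg x _) (injOn_exp_neg _)] at h
  simpa only [abs_neg, Real.abs_exp, exp_neg_smul_cpow] using h

theorem IsWeight.mellin_eq_laplace {φ : ℝ → ℂ} {σ₀ σ₁ : ℝ} (hφ : IsWeight φ σ₀ σ₁) (s : ℂ) :
    mellin φ s = laplace (fun x => φ (Real.exp (-x))) s := by
  have h1 : mellin φ s = ∫ t in Ioo (0 : ℝ) 1, (t : ℂ) ^ (s - 1) • φ t := by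
    rw [mellin, ← integral_Ioc_eq_integral_Ioo]
    refine setIntegral_eq_of_subset_of_forall_sdiff_eq_zero measurableSet_Ioi Ioc_subset_Ioi_self
      fun t ht => ?_
    rw [hφ.support t, smul_zero]
    by_contra h
    exact ht.2 ⟨ht.1, not_lt.1 h⟩
  rw [h1, ← image_exp_neg_Ioi, integral_image_eq_integral_abs_deriv_smul
    measurableSet_Ioi (fun x _ => hasDerivWithinAt_exp_neg x _) (injOn_exp_neg _)]
  simp only [abs_neg, Real.abs_exp, exp_neg_smul_cpow, laplace]

/-! ### Laplace transform of the smoothed partial sums -/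

/-- The smoothed partial sum `∑_{n < e^x} a_n φ(n e^{-x})`. -/
noncomputable def partialSum (a : ℕ → ℂ) (φ : ℝ → ℂ) (x : ℝ) : ℂ :=
  ∑ n ∈ Finset.Ico 1 ⌈Real.exp x⌉₊, a n * φ ((n : ℝ) / Real.exp x)

/-- The function `e^{-sx} φ(e^{-x})` on `(0, ∞)`, extended by zero. -/
noncomputable def weightKernel (φ : ℝ → ℂ) (s : ℂ) : ℝ → ℂ :=
  indicator (Ioi 0) fun x => Complex.exp (-s * x) * φ (Real.exp (-x))

theorem weightKernel_eq_zero (φ : ℝ → ℂ) (s : ℂ) {x : ℝ} {n : ℕ} (hn : n ∉ Finset.Ico 1 ⌈Real.exp x⌉₊)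
    (a : ℕ → ℂ) : LSeries.term a s n * weightKernel φ s (x - Real.log n) = 0 := by
  rcases Nat.eq_zero_or_pos n with h0 | h0
  · simp [h0]
  · have h1 : Real.exp x ≤ n := by
      rw [Finset.mem_Ico, not_and, not_lt] at hn
      exact Nat.ceil_le.1 (hn h0)
    have h2 : x ≤ Real.log n := (Real.le_log_iff_exp_le (by exact_mod_cast h0)).2 h1
    -- The open half-line in `weightKernel` also kills `n = e^x`, matching the strict inequality `n
    -- < u` in `psi`.
    rw [weightKernel, indicator_of_notMem (by simpa using h2), mul_zero]

theorem term_mul_weightKernel (a : ℕ → ℂ) (φ : ℝ → ℂ) (s : ℂ) {x : ℝ} {n : ℕ}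
    (hn : n ∈ Finset.Ico 1 ⌈Real.exp x⌉₊) :
    LSeries.term a s n * weightKernel φ s (x - Real.log n)
      = Complex.exp (-s * x) * (a n * φ ((n : ℝ) / Real.exp x)) := by
  obtain ⟨h0, h1⟩ := Finset.mem_Ico.1 hn
  have h0' : (0 : ℝ) < n := by exact_mod_cast h0
  have h2 : Real.log n < x := by
    rw [Real.log_lt_iff_lt_exp h0']
    exact Nat.lt_ceil.1 h1
  rw [weightKernel, indicator_of_mem (by simpa using h2), LSeries.term_of_ne_zero (by omega),
    neg_sub, Real.exp_sub, Real.exp_log h0', Complex.cpow_def_of_ne_zero (by exact_mod_cast h0'.ne'),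
    div_eq_mul_inv, ← Complex.exp_neg, ← Complex.natCast_log]
  have : Complex.exp (-(((Real.log n : ℝ) : ℂ) * s)) * Complex.exp (-s * ((x - Real.log n : ℝ) : ℂ))
      = Complex.exp (-s * x) := by
    rw [← Complex.exp_add]
    congr 1
    push_cast
    ring
  rw [← this]
  ring

/-- In the variable `x` the dilation by `n` is a translation by `log n`. This yields measurability
of the partial sums and, after termwise integration, their transform. -/
theorem hasSum_term_mul_weightKernel (a : ℕ → ℂ) (φ : ℝ → ℂ) (s : ℂ) (x : ℝ) :
    HasSum (fun n => LSeries.term a s n * weightKernel φ s (x - Real.log n))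
      (Complex.exp (-s * x) * partialSum a φ x) := by
  rw [partialSum, Finset.mul_sum, ← Finset.sum_congr rfl
    fun n hn => term_mul_weightKernel a φ s hn]
  exact hasSum_sum_of_ne_finset_zero fun n hn => weightKernel_eq_zero φ s hn a

theorem partialSum_of_nonpos (a : ℕ → ℂ) (φ : ℝ → ℂ) {x : ℝ} (hx : x ≤ 0) :
    partialSum a φ x = 0 := by
  have : ⌈Real.exp x⌉₊ ≤ 1 := Nat.ceil_le.2 (by simpa using hx)
  rw [partialSum, Finset.Ico_eq_empty_of_le this, Finset.sum_empty]

theorem IsWeight.integrable_weightKernel {φ : ℝ → ℂ} {σ₀ σ₁ : ℝ} (hφ : IsWeight φ σ₀ σ₁) {s : ℂ}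
    (hs : σ₀ < s.re) : Integrable (weightKernel φ s) :=
  (integrable_indicator_iff measurableSet_Ioi).2 (hφ.integrableOn_laplace hs)

theorem IsWeight.aestronglyMeasurable_partialSum {φ : ℝ → ℂ} {σ₀ σ₁ : ℝ}
    (hφ : IsWeight φ σ₀ σ₁) (a : ℕ → ℂ) : AEStronglyMeasurable (partialSum a φ) := by
  -- Any `s` with `Re s > σ₀` would do: it only makes the kernel integrable, and `e^{-sx}` is
  -- divided out at the end.
  set s : ℂ := ((σ₀ + 1 : ℝ) : ℂ) with hs
  have hK := hφ.integrable_weightKernel (s := s) (by simp [hs])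
  have h1 : AEStronglyMeasurable (fun x : ℝ => Complex.exp (-s * x) * partialSum a φ x) := by
    refine aestronglyMeasurable_of_tendsto_ae atTop
      (f := fun (N : ℕ) x => ∑ n ∈ Finset.range N,
        LSeries.term a s n * weightKernel φ s (x - Real.log n)) (fun N => ?_)
      (Eventually.of_forall fun x => (hasSum_term_mul_weightKernel a φ s x).tendsto_sum_nat)
    refine Finset.aestronglyMeasurable_fun_sum _ fun n _ => ?_
    exact ((hK.comp_sub_right (Real.log n)).const_mul _).aestronglyMeasurable
  have h2 : AEStronglyMeasurable
      (fun x : ℝ => Complex.exp (s * x) * (Complex.exp (-s * x) * partialSum a φ x)) :=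
    (Continuous.aestronglyMeasurable (by fun_prop)).mul h1
  refine h2.congr (Eventually.of_forall fun x => ?_)
  simp only
  rw [← mul_assoc, ← Complex.exp_add]
  simp

/-- The Laplace transform of the smoothed partial sums is `L φ̂`. -/
theorem IsWeight.laplace_partialSum {φ : ℝ → ℂ} {σ₀ σ₁ : ℝ} (hφ : IsWeight φ σ₀ σ₁) {a : ℕ → ℂ}
    {s : ℂ} (hs : σ₀ < s.re) (ha : LSeriesSummable a s) :
    laplace (partialSum a φ) s = LSeries a s * mellin φ s := by
  have hK := hφ.integrable_weightKernel hs
  have hint : ∀ n, Integrable fun x => LSeries.term a s n * weightKernel φ s (x - Real.log n) :=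
    fun n => (hK.comp_sub_right (Real.log n)).const_mul _
  have hnorm : ∀ n, ∫ x, ‖LSeries.term a s n * weightKernel φ s (x - Real.log n)‖
      = ‖LSeries.term a s n‖ * ∫ x, ‖weightKernel φ s x‖ := by
    intro n
    simp only [norm_mul]
    rw [integral_const_mul, integral_sub_right_eq_self (fun x => ‖weightKernel φ s x‖)]
  have h := hasSum_integral_of_summable_integral_norm hint (by
    simp only [hnorm]
    exact ha.norm.mul_right _)
  have hval : ∀ n, ∫ x, LSeries.term a s n * weightKernel φ s (x - Real.log n)
      = LSeries.term a s n * mellin φ s := by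
    intro n
    rw [integral_const_mul, integral_sub_right_eq_self (weightKernel φ s), weightKernel,
      integral_indicator measurableSet_Ioi, hφ.mellin_eq_laplace, laplace]
  simp only [hval, (hasSum_term_mul_weightKernel a φ s _).tsum_eq] at h
  have h2 : laplace (partialSum a φ) s = ∫ x : ℝ, Complex.exp (-s * x) * partialSum a φ x := by
    rw [laplace]
    refine setIntegral_eq_integral_of_forall_compl_eq_zero fun x hx => ?_
    rw [partialSum_of_nonpos a φ (not_lt.1 hx), mul_zero]
  rw [h2, ← h.tsum_eq, tsum_mul_right]
  rfl

/-! ### The compensated product as a Laplace transform -/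

theorem laplace_exp_mul (c : ℂ) (f : ℝ → ℂ) (s : ℂ) :
    laplace (fun x => Complex.exp (-c * x) * f x) s = laplace f (s + c) := by
  simp only [laplace, ← mul_assoc, ← Complex.exp_add]
  congr 1 with x
  ring_nf

theorem memLp_weighted_psi {a : ℕ → ℂ} {L : ℂ → ℂ} {φ : ℝ → ℂ} {σ₀ σ₁ : ℝ}
    (hφ : IsWeight φ σ₀ σ₁) {P : Polynomial ℂ}
    (hP : ∀ u : ℝ, 0 < u → psiOne L φ u = u * P.eval (Real.log u : ℂ)) {r₀ r : ℝ}
    (hψ : IntegrableOn (fun t : ℝ => ‖psi a L φ t‖ ^ 2 / t ^ (1 + 2 * r₀)) (Ioi 1))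
    (hr : r₀ ≤ r) :
    MemLp (fun x : ℝ => (Real.exp (-r * x) : ℂ) * psi a L φ (Real.exp x)) 2
      (volume.restrict (Ioi 0)) := by
  rw [integrableOn_Ioi_one_iff] at hψ
  have hm : AEStronglyMeasurable
      (fun x : ℝ => (Real.exp (-r * x) : ℂ) * psi a L φ (Real.exp x)) := by
    refine (Continuous.aestronglyMeasurable (by fun_prop)).mul (AEStronglyMeasurable.sub ?_
      (hφ.aestronglyMeasurable_partialSum a))
    have : (fun x : ℝ => psiOne L φ (Real.exp x))
        = fun x : ℝ => (Real.exp x : ℂ) * P.eval (x : ℂ) := by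
      funext x
      rw [hP _ (Real.exp_pos x), Real.log_exp]
    rw [this]
    have := P.continuous.comp Complex.continuous_ofReal
    exact Continuous.aestronglyMeasurable
      ((by fun_prop : Continuous fun x : ℝ => (Real.exp x : ℂ)).mul this)
  refine (memLp_two_iff_integrable_sq_norm hm.restrict).2
    (Integrable.mono' hψ (hm.restrict.norm.pow 2) ?_)
  filter_upwards [ae_restrict_mem measurableSet_Ioi] with x hx
  have hx : 0 < x := hx
  rw [Real.norm_of_nonneg (by positivity), norm_mul, norm_mul, Complex.norm_real,
    Complex.norm_real, Real.norm_of_nonneg (Real.exp_pos _).le,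
    Real.norm_of_nonneg (Real.exp_pos _).le]
  gcongr

/-- The function `L φ̂ b_{1,r}^m` on `Π_r` is the Laplace transform of a square integrable function,
whose norm is at most the norm of `ψ` on `(0, ∞)`. -/
theorem exists_laplace_eq {a : ℕ → ℂ} {L : ℂ → ℂ} {φ : ℝ → ℂ} {σ₀ σ₁ : ℝ} {m : ℕ}
    (hL : IsContinuedDirichletSeries a L σ₀ m) (hφ : IsWeight φ σ₀ σ₁) {r₀ : ℝ} (hr₀ : σ₀ < r₀)
    (hψ : IntegrableOn (fun t : ℝ => ‖psi a L φ t‖ ^ 2 / t ^ (1 + 2 * r₀)) (Ioi 1))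
    {r : ℝ} (hr₀r : r₀ ≤ r) (hr : r < 1) :
    ∃ h : ℝ → ℂ, MemLp h 2 (volume.restrict (Ioi 0)) ∧
      ∫ x in Ioi (0 : ℝ), ‖h x‖ ^ 2
        ≤ weightedNorm (Ioo 0 1) r (psiOne L φ) ^ 2 + weightedNorm (Ioi 1) r (psi a L φ) ^ 2 ∧
      ∀ s : ℂ, 0 < s.re → s + r ≠ 1 →
        laplace h s = -(L (s + r) * mellin φ (s + r) * blaschke 1 r (s + r) ^ m) := by
  obtain ⟨Lt, hLtd, hLt⟩ := hL.exists_holomorphic_multiple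
  have hσr : σ₀ < r := hr₀.trans_le hr₀r
  have hσ1 := hL.sigma_lt_one
  have hφd : DifferentiableOn ℂ (mellin φ) (halfPlane σ₀) := fun s hs =>
    (hφ.differentiableAt_mellin hs).differentiableWithinAt
  have hnhds : halfPlane σ₀ ∈ 𝓝 (1 : ℂ) := (isOpen_halfPlane σ₀).mem_nhds (by simpa [halfPlane])
  have hpole : ∃ P : Polynomial ℂ, P.degree < m ∧
      ∀ u : ℝ, 0 < u → psiOne L φ u = u * P.eval (Real.log u : ℂ) := by
    obtain ⟨n, rfl⟩ : ∃ n, m = n + 1 := ⟨m - 1, (Nat.sub_add_cancel hL.one_le_order).symm⟩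
    refine exists_polynomial_psiOne (Lt := Lt) ?_ ?_ ?_
    · filter_upwards [(isOpen_halfPlane σ₀).eventually_mem (mem_of_mem_nhds hnhds)] with s hs
      exact hLtd.differentiableAt ((isOpen_halfPlane σ₀).mem_nhds hs)
    · filter_upwards [self_mem_nhdsWithin] with s hs using hLt s hs
    · filter_upwards [hnhds] with s hs using hφ.differentiableAt_mellin hs
  obtain ⟨P, hPd, hP⟩ := hpole
  set α : ℝ := 1 - r with hα
  have hα0 : 0 < α := by linarith
  set q : ℝ → ℂ := fun x => -(Complex.exp (-(r : ℂ) * x) * partialSum a φ x) with hq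
  have hf : ∀ x : ℝ, expPoly α P x + q x
      = (Real.exp (-r * x) : ℂ) * psi a L φ (Real.exp x) := by
    intro x
    have h1 : psi a L φ (Real.exp x) = psiOne L φ (Real.exp x) - partialSum a φ x := rfl
    rw [h1, hP _ (Real.exp_pos x), Real.log_exp, expPoly, hq, mul_sub, ← mul_assoc,
      ← Complex.ofReal_mul, ← Real.exp_add]
    push_cast
    rw [hα]
    push_cast
    ring_nf
  have hmem := memLp_weighted_psi hφ hP hψ hr₀r
  simp only [← hf] at hmem
  obtain ⟨h, hh, hle, hlap⟩ := exists_memLp_laplace hα0 m P q hPd hmem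
  have hlq : ∀ s : ℂ, α < s.re → laplace q s = -(L (s + r) * mellin φ (s + r)) := by
    intro s hs
    have hs1 : 1 < (s + r).re := by simp; linarith
    have hsum : LSeriesSummable a (s + r) := by
      obtain ⟨ε, hε, hε1⟩ : ∃ ε : ℝ, 0 < ε ∧ 1 + ε < (s + r).re :=
        ⟨((s + r).re - 1) / 2, by linarith, by linarith⟩
      exact LSeriesSummable_of_isBigO_rpow hε1 (by simpa using hL.coeff_growth ε hε)
    rw [hL.eq_series _ hs1, ← hφ.laplace_partialSum (by linarith) hsum, ← laplace_exp_mul]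
    simp only [hq, laplace, mul_neg, integral_neg]
  refine ⟨h, hh, ?_, ?_⟩
  · refine hle.trans (le_of_eq ?_)
    rw [weightedNorm_Ioo_zero_one, weightedNorm_Ioi_one,
      Real.sq_sqrt (integral_nonneg fun x => by positivity),
      Real.sq_sqrt (integral_nonneg fun x => by positivity)]
    simp only [hf]
    congr 2 with x
    rw [hP _ (Real.exp_pos _), Real.log_exp, ← mul_assoc, ← Complex.ofReal_mul, ← Real.exp_add,
      expPoly]
    rw [hα]
    ring_nf
  · have hopen := isOpen_halfPlane 0
    have hconv : Convex ℝ (halfPlane 0) := convex_halfSpace_re_gt 0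
    have hmaps : ∀ s ∈ halfPlane 0, s + (r : ℂ) ∈ halfPlane σ₀ := by
      intro s hs
      have hs : 0 < s.re := hs
      change σ₀ < (s + (r : ℂ)).re
      simp
      linarith
    -- The formula is known only for `Re s > α`. With the denominator cleared and the pole absorbed
    -- in `Lt`, both sides are holomorphic for `Re s > 0`, and the identity theorem extends it.
    have hA : DifferentiableOn ℂ (fun s => (s + α) ^ m * laplace h s) (halfPlane 0) := by
      intro s hs
      exact ((by fun_prop : DifferentiableAt ℂ (fun s : ℂ => (s + α) ^ m) s).mul
        (differentiableAt_laplace hh hs)).differentiableWithinAt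
    have hB : DifferentiableOn ℂ (fun s => -(Lt (s + r) * mellin φ (s + r))) (halfPlane 0) :=
      (((hLtd.mul hφd).comp (by fun_prop : DifferentiableOn ℂ (fun s : ℂ => s + r) _) hmaps)).neg
    have hev : (fun s => (s + α) ^ m * laplace h s)
        =ᶠ[𝓝 ((α + 1 : ℝ) : ℂ)] fun s => -(Lt (s + r) * mellin φ (s + r)) := by
      filter_upwards [(isOpen_halfPlane α).mem_nhds
        (by simp [halfPlane] : ((α + 1 : ℝ) : ℂ) ∈ halfPlane α)] with s hs
      have hs : α < s.re := hs
      have hne : s + r ≠ 1 := fun h => by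
        have := congrArg Complex.re h
        simp at this
        linarith
      have hne2 : s + (α : ℂ) ≠ 0 := fun h => by
        have := congrArg Complex.re h
        simp at this
        linarith
      have h1 : s + r - 1 = s - α := by rw [hα]; push_cast; ring
      rw [hlap s hs, hlq s hs, hLt _ hne, h1, div_pow]
      field_simp
    have heq := (hA.analyticOnNhd hopen).eqOn_of_preconnected_of_eventuallyEq
      (hB.analyticOnNhd hopen) hconv.isPreconnected
      (by simp [halfPlane]; linarith : ((α + 1 : ℝ) : ℂ) ∈ halfPlane 0) hev
    intro s hs hne
    have hne2 : s + (α : ℂ) ≠ 0 := fun h => by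
      have := congrArg Complex.re h
      simp at this
      linarith
    have h := heq hs
    simp only [hLt _ hne] at h
    have h1 : s + r - 1 = s - α := by rw [hα]; push_cast; ring
    have h2 : s + r + conj (1 : ℂ) - 2 * (r : ℂ) = s + α := by rw [hα, map_one]; push_cast; ring
    rw [blaschke, h2, h1, div_pow]
    rw [h1] at h
    field_simp
    linear_combination h

theorem compensatedValue_eq {L : ℂ → ℂ} {φ : ℝ → ℂ} {m : ℕ} {r : ℝ} {h : ℝ → ℂ}
    (hh : MemLp h 2 (volume.restrict (Ioi 0)))
    (heq : ∀ s : ℂ, 0 < s.re → s + r ≠ 1 →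
      laplace h s = -(L (s + r) * mellin φ (s + r) * blaschke 1 r (s + r) ^ m))
    {s : ℂ} (hs : 0 < s.re) : compensatedValue L φ m r (s + r) = -laplace h s := by
  have hcont : ContinuousAt (fun z : ℂ => -laplace h (z - r)) (s + r) := by
    refine ContinuousAt.neg (ContinuousAt.comp (g := laplace h) ?_ (by fun_prop))
    rw [add_sub_cancel_right]
    exact (differentiableAt_laplace hh hs).continuousAt
  have hlim : Tendsto (fun z : ℂ => -laplace h (z - r)) (𝓝[≠] (s + r)) (𝓝 (-laplace h s)) := by
    have := hcont.tendsto.mono_left (nhdsWithin_le_nhds (s := {s + (r : ℂ)}ᶜ))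
    rwa [add_sub_cancel_right] at this
  refine Tendsto.limUnder_eq (hlim.congr' ?_)
  have hre : ∀ᶠ z in 𝓝[≠] (s + (r : ℂ)), r < z.re :=
    nhdsWithin_le_nhds
      ((isOpen_halfPlane r).mem_nhds (by simpa [halfPlane] : s + (r : ℂ) ∈ halfPlane r))
  have hne : ∀ᶠ z in 𝓝[≠] (s + (r : ℂ)), z ≠ 1 := by
    by_cases h1 : s + (r : ℂ) = 1
    · rw [h1]
      exact self_mem_nhdsWithin
    · exact nhdsWithin_le_nhds (isOpen_ne.mem_nhds h1)
  filter_upwards [hre, hne] with z h1 h2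
  rw [heq (z - r) (by simpa using h1) (by simpa using h2), neg_neg, sub_add_cancel]

/-! ### The zero-free disc -/

/-- Here `|s + conj w|² - |s - w|² = 4 Re s Re w`. -/
theorem re_pos_of_norm_div_lt_one {s w : ℂ} (hw : 0 < w.re) (hne : s + conj w ≠ 0)
    (h : ‖(s - w) / (s + conj w)‖ < 1) : 0 < s.re := by
  rw [norm_div, div_lt_one (norm_pos_iff.2 hne)] at h
  have h2 := mul_self_lt_mul_self (norm_nonneg _) h
  rw [Complex.norm_mul_self_eq_normSq, Complex.norm_mul_self_eq_normSq, Complex.normSq_apply,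
    Complex.normSq_apply] at h2
  simp only [Complex.sub_re, Complex.sub_im, Complex.add_re, Complex.add_im, Complex.conj_re,
    Complex.conj_im] at h2
  by_contra hs
  nlinarith

end ZeroFreeDisc

theorem proposition6p1 (a : ℕ → ℂ) (L : ℂ → ℂ) (φ : ℝ → ℂ) (σ₀ σ₁ : ℝ) (m : ℕ)
    (hL : ZeroFreeDisc.IsContinuedDirichletSeries a L σ₀ m)
    (hφ : ZeroFreeDisc.IsWeight φ σ₀ σ₁)
    (r₀ : ℝ) (hr₀ : σ₀ < r₀)
    (hψ : IntegrableOn (fun t : ℝ => ‖ZeroFreeDisc.psi a L φ t‖ ^ 2 / t ^ (1 + 2 * r₀)) (Ioi 1))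
    (r : ℝ) (hr₀r : r₀ ≤ r) (hr : r < 1)
    (lam : ℂ) (hlam : lam ∈ ZeroFreeDisc.halfPlane σ₀) :
    ∀ μ ∈ ZeroFreeDisc.disc lam σ₀
        (Real.sqrt (2 * (lam.re - σ₀)) * ZeroFreeDisc.radius a L φ σ₀ m r lam),
      (r : ℂ) - (σ₀ : ℂ) + μ ≠ 1 → L ((r : ℂ) - (σ₀ : ℂ) + μ) ≠ 0 := by
  intro μ hμ hμ1 hzero
  obtain ⟨h, hh, hle, heq⟩ := ZeroFreeDisc.exists_laplace_eq hL hφ hr₀ hψ hr₀r hr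
  have hlam : σ₀ < lam.re := hlam
  set w : ℂ := lam - σ₀ with hw
  set s : ℂ := μ - σ₀ with hs
  have hw0 : 0 < w.re := by simpa [hw] using hlam
  have hwre : lam.re - σ₀ = w.re := by simp [hw]
  obtain ⟨hne, hlt⟩ := hμ
  have e1 : μ - lam = s - w := by rw [hs, hw]; ring
  have e2 : μ + conj lam - 2 * (σ₀ : ℂ) = s + conj w := by
    rw [hs, hw, map_sub, Complex.conj_ofReal]; ring
  have e3 : lam + (r : ℂ) - (σ₀ : ℂ) = w + r := by rw [hw]; ring
  have e4 : (r : ℂ) - (σ₀ : ℂ) + μ = s + r := by rw [hs]; ring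
  rw [e4] at hμ1 hzero
  rw [e2] at hne
  rw [ZeroFreeDisc.radius, e1, e2, e3, hwre, ZeroFreeDisc.compensatedValue_eq hh heq hw0,
    norm_neg] at hlt
  set A := ZeroFreeDisc.weightedNorm (Ioo 0 1) r (ZeroFreeDisc.psiOne L φ)
  set B := ZeroFreeDisc.weightedNorm (Ioi 1) r (ZeroFreeDisc.psi a L φ)
  have hA : 0 ≤ A := Real.sqrt_nonneg _
  have hB : 0 ≤ B := Real.sqrt_nonneg _
  set V := ‖ZeroFreeDisc.laplace h w‖
  -- The argument bounds the integral by `A² + B²`; passing to `(A + B)²` gives the stated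
  -- denominator.
  have hN : ∫ x in Ioi (0 : ℝ), ‖h x‖ ^ 2 ≤ (A + B) ^ 2 := by nlinarith [mul_nonneg hA hB]
  rcases (add_nonneg hA hB).eq_or_lt with hD | hD
  -- Division by zero makes the radius `0`, and the disc is empty.
  · rw [← hD, div_zero, mul_zero] at hlt
    exact absurd hlt (not_lt.2 (norm_nonneg _))
  have hρ : ∀ t : ℝ, 0 ≤ t → V ^ 2 * (2 * w.re) ≤ t ^ 2 * (A + B) ^ 2 →
      √(2 * w.re) * (V / (A + B)) ≤ t := by
    intro t ht hVt
    rw [← mul_div_assoc, div_le_iff₀ hD]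
    refine le_of_sq_le_sq ?_ (by positivity)
    rw [mul_pow, mul_pow, Real.sq_sqrt (by linarith)]
    linarith
  -- The bound without a zero shows that the radius is at most `1`, so the disc stays in the
  -- half-plane where `h` represents the product.
  have hs0 : 0 < s.re := by
    refine ZeroFreeDisc.re_pos_of_norm_div_lt_one hw0 hne (hlt.trans_le (hρ 1 zero_le_one ?_))
    rw [one_pow, one_mul]
    exact (ZeroFreeDisc.norm_laplace_sq_le hh hw0).trans hN
  have hlap0 : ZeroFreeDisc.laplace h s = 0 := by
    rw [heq s hs0 hμ1, hzero]
    simp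
  exact absurd hlt (not_lt.2 (hρ _ (norm_nonneg _)
    ((ZeroFreeDisc.norm_laplace_sq_le_of_zero hh hw0 hs0 hlap0).trans (by gcongr))))
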